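/- Let $\mathbb{T}=\{z\in\mathbb{C}:|z|=1\}$. Fix the following data. (i) A $C$-sequence $\langle C_\alpha:\alpha<\omega_1\rangle$: $C_{\xi+1}=\{\xi\}$, and for limit $\alpha<\omega_1$ the set $C_\alpha\subseteq\alpha$ is cofinal in $\alpha$ and of order type $\omega$. (ii) Functions $e_\alpha:\alpha\to\omega$ $(\alpha<\omega_1)$ that are finite-to-one and coherent, i.e. $\{\xi<\alpha: e_\beta(\xi)\ne e_\alpha(\xi)\}$ is finite whenever $\alpha<\beta<\omega_1$. (iii) Rationally independent elements $z_\alpha\in\mathbb{T}$ $(\alpha<\omega_1)$, i.e. a finite product $\prod_i z_{\alpha_i}^{n_i}$ with distinct $\alpha_i$ and $n_i\in\mathbb{Z}$ equals $1$ only if all $n_i=0$. For $\alpha<\beta<\omega_1$ let $\beta=\beta_0>\beta_1>\dots>\beta_l=\alpha$ be the walk $\beta_{i+1}=\min(C_{\beta_i}\setminus\alpha)$, put $\xi_k=\max\bigcup_{j\le k}(C_{\beta_j}\cap\alpha)$ for $k<l$ (with $\max\emptyset=0$), and let $L(\alpha,\beta)=\{\xi_k:k<l\}$. Let $\mathrm{osc}(\alpha,\beta)$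 be the number of $\xi\in L(\alpha,\beta)$ that have an immediate successor $\xi^+$ in $L(\alpha,\beta)$ and satisfy $e_\alpha(\xi)\le e_\beta(\xi)$ and $e_\alpha(\xi^+)>e_\beta(\xi^+)$. Put $o(\alpha,\beta)=z_\alpha^{\mathrm{osc}(\alpha,\beta)+1}$, and for $\beta<\omega_1$ define $w_\beta:\omega_1\to\mathbb{T}$ by $w_\beta(\xi)=o(\xi,\beta)$ if $\xi<\beta$ and $w_\beta(\xi)=1$ otherwise. For $X\subseteq\omega_1$ let $\mathscr{L}_X=\{w_\beta\restriction X:\beta\in X\}$, viewed as a subspace of $\mathbb{T}^X$ with the product topology. **Theorem.** For all such data and every $X\subseteq\omega_1$, the space $\mathscr{L}_X$ is hereditarily Lindelöf. Moreover, if $X$ is uncountable, then $\mathscr{L}_X$ is an L-space, that is, a $T_3$ (regular Hausdorff) hereditarily Lindelöf space that is not separable (and so not hereditarily separable). **Corollary.** There exists (in ZFC) an L-space. -/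

import Mathlib

namespace MooreLSpace

open Set Ordinal

/-- The well-ordered set `ω₁` of all countable ordinals. -/
abbrev Omega1 : Type := (Ordinal.omega 1 : Ordinal.{0}).ToType

instance : Nonempty Omega1 :=
  Ordinal.nonempty_toType_iff.2 (Ordinal.omega_pos 1).ne'

noncomputable instance : OrderBot Omega1 :=
  WellFoundedLT.toOrderBot Omega1

/-- Infima and suprema in `ω₁` of nonempty (bounded) sets; the supremum of `∅` is `0`. -/
noncomputable instance : ConditionallyCompleteLinearOrderBot Omega1 :=
  WellFoundedLT.conditionallyCompleteLinearOrderBot Omega1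

/-- `⟨C_α : α < ω₁⟩` is a `C`-sequence: `C_{ξ+1} = {ξ}`, and for limit `α` the set `C_α` is a
cofinal subset of `α` of order type `ω`. (Nothing is required of `C_0`, which is never used.) -/
structure IsCSequence (C : Omega1 → Set Omega1) : Prop where
  succ : ∀ ξ α : Omega1, ξ ⋖ α → C α = {ξ}
  subset : ∀ α : Omega1, Order.IsSuccLimit α → C α ⊆ Iio α
  cofinal : ∀ α : Omega1, Order.IsSuccLimit α → ∀ ξ < α, ∃ η ∈ C α, ξ ≤ η
  orderType : ∀ α : Omega1, Order.IsSuccLimit α → Nonempty (ℕ ≃o C α)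

/-- The walk from `β` to `α`: `β_0 = β` and `β_{i+1} = min (C_{β_i} ∖ α)`. -/
noncomputable def walk (C : Omega1 → Set Omega1) (α β : Omega1) : ℕ → Omega1
  | 0 => β
  | i + 1 => sInf (C (walk C α β i) \ Iio α)

/-- The length `l` of the walk from `β` to `α`: the first `l` with `β_l = α`. -/
noncomputable def walkLength (C : Omega1 → Set Omega1) (α β : Omega1) : ℕ :=
  sInf {i | walk C α β i = α}

/-- `ξ_k = max ⋃_{j ≤ k} (C_{β_j} ∩ α)`, with the convention `max ∅ = 0`.
For `k` below the length of the walk the union is finite, so this supremum is a maximum. -/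
noncomputable def lowerPoint (C : Omega1 → Set Omega1) (α β : Omega1) (k : ℕ) : Omega1 :=
  sSup (⋃ j ≤ k, C (walk C α β j) ∩ Iio α)

/-- The lower trace `L(α,β) = {ξ_0, …, ξ_{l-1}}`. -/
noncomputable def lowerTrace (C : Omega1 → Set Omega1) (α β : Omega1) : Finset Omega1 :=
  (Finset.range (walkLength C α β)).image (lowerPoint C α β)

/-- A coherent sequence of finite-to-one functions `e_α : α → ω`. Each `e_α` is represented by a
function on all of `ω₁`, of which only the values at `ξ < α` play a role. -/
structure IsCoherentFiniteToOne (e : Omega1 → Omega1 → ℕ) : Prop where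
  finiteToOne : ∀ (α : Omega1) (n : ℕ), {ξ | ξ < α ∧ e α ξ = n}.Finite
  coherent : ∀ α β : Omega1, α < β → {ξ | ξ < α ∧ e β ξ ≠ e α ξ}.Finite

open Classical in
/-- `Osc(f, g, L)`: the set of those `ξ ∈ L` having a next element `η` in `L` such that
`f(ξ) ≤ g(ξ)` and `f(η) > g(η)`. -/
noncomputable def oscSet (f g : Omega1 → ℕ) (L : Finset Omega1) : Finset Omega1 :=
  L.filter fun ξ => ∃ η, IsLeast {ζ | ζ ∈ L ∧ ξ < ζ} η ∧ f ξ ≤ g ξ ∧ g η < f η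

/-- `osc(α,β) = |Osc(e_α, e_β, L(α,β))|` -/
noncomputable def osc (C : Omega1 → Set Omega1) (e : Omega1 → Omega1 → ℕ) (α β : Omega1) : ℕ :=
  (oscSet (e α) (e β) (lowerTrace C α β)).card

/-- Rational independence of elements of the circle group: no nontrivial product
`∏ z_α ^ n_α` with integer exponents is equal to `1`. -/
def RationallyIndependent (z : Omega1 → Circle) : Prop :=
  LinearIndependent ℤ fun α => Additive.ofMul (z α)

/-- `o(α,β) = z_α ^ (osc(α,β) + 1)`, used for `α < β`. -/
noncomputable def o (C : Omega1 → Set Omega1) (e : Omega1 → Omega1 → ℕ) (z : Omega1 → Circle)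
    (α β : Omega1) : Circle :=
  z α ^ (osc C e α β + 1)

/-- `w_β : ω₁ → 𝕋`, with `w_β(ξ) = o(ξ,β)` for `ξ < β` and `w_β(ξ) = 1` otherwise. -/
noncomputable def w (C : Omega1 → Set Omega1) (e : Omega1 → Omega1 → ℕ) (z : Omega1 → Circle)
    (β ξ : Omega1) : Circle :=
  if ξ < β then o C e z ξ β else 1

/-- `𝓛_X = {w_β ↾ X : β ∈ X}`, a subset of the product space `𝕋 ^ X`. -/
def spaceL (C : Omega1 → Set Omega1) (e : Omega1 → Omega1 → ℕ) (z : Omega1 → Circle)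
    (X : Set Omega1) : Set (X → Circle) :=
  (fun β => X.domRestrict (w C e z β)) '' X

/-- An L-space: a `T₃` (regular Hausdorff) hereditarily Lindelöf space that is not separable
(hence not hereditarily separable). -/
structure IsLSpace (Y : Type*) [TopologicalSpace Y] : Prop where
  t3 : T3Space Y
  hereditarilyLindelof : HereditarilyLindelofSpace Y
  not_separable : ¬ TopologicalSpace.SeparableSpace Y

end MooreLSpace

/-!
The proof follows Moore. Write `L(α,β)` for the lower trace of the walk from `β` to `α`. If `L(β,γ)`
lies below `L(α,β)`, then `L(α,γ)` is the concatenation of the two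
(`IsCSequence.lowerTrace_eq_union`), and `min L(α,δ)` tends to `δ` as `α` tends to a limit ordinal
`δ` (`IsCSequence.exists_forall_lt_lowerTrace`).

Let `A` be a family of finite tuples that has members arbitrarily high in `ω₁`, let `B` be an
uncountable subset of `ω₁`, and let `δ` be an ordinal closed under finitely many Skolem functions
(`IsReflecting`, which replaces the trace of a countable elementary submodel). Given `a` in `A` and
`b` in `B` above `δ`, reflection produces some `δ' > δ` below a similar pair, so that the new
`L(δ,b)` is the old one followed by the block `L(δ,δ')`. Coherence makes the functions `e` of the
new tuple and of the new ordinal agree on this block; as each `e_α` is finite-to-one, the tuple can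
instead be chosen with values exceeding those of `e_b` there
(`IsCoherentFiniteToOne.exists_large`, `IsReflecting.exists_end_extension`). A block of equality
followed by a block of strict excess adds exactly one oscillation. Iterating this, and reflecting
the last tuple below `δ`, gives a tuple `a` in `A` and ordinals `b_m` in `B` such that
`osc(a(i), b_m) = osc(a(i), b_0) + m` for all `i` (`exists_osc_eq_add`).

By Kronecker's theorem (`dense_range_pow`) the values `o(a(i), β)`, for `a` in `A` and `β` in `B`
above it, hence meet every nonempty open subset of the torus (`exists_o_mem`). If some subspace of
`𝓛_X` were not Lindelöf, a greedy choice would give uncountably many points `w_γ` with basic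
neighbourhoods that exclude all later points; thinning these out by a `Δ`-system argument, with
`γ` itself among the coordinates that determine the neighbourhood of `w_γ`, contradicts this
density (`exists_lt_forall_dist_lt`). Non-separability holds because countably many `w_β` are all
equal to `1` from some point on. For the existence of an L-space, the function `ρ₁` of Todorcevic
provides a coherent finite-to-one sequence, and a basis of `ℝ` over `ℚ` provides the `z_α`.
-/

namespace MooreLSpace

open Set

/-! ### Countable sets in `ω₁` -/

section Walks

theorem countable_Iio (δ : Omega1) : (Iio δ).Countable := by
  have h := Cardinal.mk_Iio_lt δ (by simp)
  rw [← Cardinal.le_aleph0_iff_set_countable, ← Cardinal.lt_aleph_one_iff]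
  simpa using h

theorem countable_Iic (δ : Omega1) : (Iic δ).Countable := by
  rw [← Iio_insert]
  exact (countable_Iio δ).insert δ

instance : Uncountable Omega1 := by
  rw [← Cardinal.aleph0_lt_mk_iff]
  simp

theorem exists_forall_lt_of_countable {S : Set Omega1} (hS : S.Countable) :
    ∃ δ, ∀ x ∈ S, x < δ := by
  by_contra! h
  refine not_countable_univ (α := Omega1) ((hS.biUnion fun x _ => countable_Iic x).mono ?_)
  intro δ _
  obtain ⟨x, hx, hδ⟩ := h δ
  exact mem_biUnion hx hδ

theorem exists_forall_lt {ι : Sort*} [Countable ι] (f : ι → Omega1) : ∃ δ, ∀ i, f i < δ := by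
  obtain ⟨δ, h⟩ := exists_forall_lt_of_countable (countable_range f)
  exact ⟨δ, fun i => h _ (mem_range_self i)⟩

instance : NoMaxOrder Omega1 :=
  ⟨fun a => (exists_forall_lt fun _ : Unit => a).imp fun _ h => h ()⟩

theorem not_countable_iff {S : Set Omega1} : ¬ S.Countable ↔ ∀ δ, ∃ x ∈ S, δ < x := by
  constructor
  · intro h δ
    by_contra! h'
    exact h ((countable_Iic δ).mono h')
  · intro h hS
    obtain ⟨δ, hδ⟩ := exists_forall_lt_of_countable hS
    obtain ⟨x, hx, hlt⟩ := h δ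
    exact (hδ x hx).not_gt hlt

theorem exists_lt_lt_of_isSuccLimit {δ x : Omega1} (hδ : Order.IsSuccLimit δ) (hx : x < δ) :
    ∃ y, x < y ∧ y < δ := by
  have := hδ.2 x
  simpa [CovBy, hx] using this

theorem bot_lt_of_isSuccLimit {δ : Omega1} (hδ : Order.IsSuccLimit δ) : ⊥ < δ :=
  bot_lt_iff_ne_bot.2 fun h => hδ.1 (h ▸ isMin_bot)

/-- There are limit ordinals closed under any function `F` of parameters `p` that have a rank `r p`
in `ω₁`, with only countably many parameters of rank below a given ordinal. -/
theorem exists_isSuccLimit_forall_lt {P : Type*} (r F : P → Omega1)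
    (hr : ∀ δ, {p | r p < δ}.Countable) :
    ∃ δ, Order.IsSuccLimit δ ∧ ∀ p, r p < δ → F p < δ := by
  have step : ∀ δ, ∃ δ', δ < δ' ∧ ∀ p, r p < δ → F p < δ' := by
    intro δ
    obtain ⟨δ', h⟩ := exists_forall_lt_of_countable (((hr δ).image F).insert δ)
    exact ⟨δ', h _ (mem_insert _ _),
      fun p hp => h _ (mem_insert_of_mem _ (mem_image_of_mem F hp))⟩
  choose g hg hgF using step
  set s : ℕ → Omega1 := fun n => g^[n] ⊥ with hs
  have hsucc : ∀ n, s (n + 1) = g (s n) := fun n => by simp [hs, Function.iterate_succ_apply']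
  have hbdd : BddAbove (range s) := by
    obtain ⟨δ, h⟩ := exists_forall_lt s
    exact ⟨δ, by rintro _ ⟨n, rfl⟩; exact (h n).le⟩
  have hlt : ∀ n, s n < ⨆ n, s n := fun n =>
    (hg (s n)).trans_le (hsucc n ▸ le_ciSup hbdd (n + 1))
  have hex : ∀ x < ⨆ n, s n, ∃ n, x < s n := fun x hx => exists_lt_of_lt_ciSup hx
  refine ⟨⨆ n, s n, ⟨fun h => (h (b := s 0) (hlt 0).le).not_gt (hlt 0), fun b hb => ?_⟩, ?_⟩
  · obtain ⟨n, hn⟩ := hex b hb.lt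
    exact hb.2 hn (hlt n)
  · intro p hp
    obtain ⟨n, hn⟩ := hex _ hp
    exact ((hgF _ p hn).trans_eq (hsucc n).symm).trans (hlt _)

/-! ### Walks and the lower trace -/

variable {C : Omega1 → Set Omega1} {α β γ δ : Omega1}

theorem eq_bot_or_covBy_or_isSuccLimit (α : Omega1) :
    α = ⊥ ∨ (∃ ξ, ξ ⋖ α) ∨ Order.IsSuccLimit α := by
  by_cases h : α = ⊥
  · exact .inl h
  by_cases h' : ∃ ξ, ξ ⋖ α
  · exact .inr (.inl h')
  · exact .inr (.inr ⟨fun hm => h (isMin_iff_eq_bot.1 hm), not_exists.1 h'⟩)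

theorem IsCSequence.lt_of_mem (hC : IsCSequence C) (h : ⊥ < β) {x : Omega1} (hx : x ∈ C β) :
    x < β := by
  rcases eq_bot_or_covBy_or_isSuccLimit β with rfl | ⟨ξ, hξ⟩ | hβ
  · exact (lt_irrefl _ h).elim
  · rw [hC.succ _ _ hξ] at hx
    exact hx ▸ hξ.lt
  · exact hC.subset _ hβ hx

theorem IsCSequence.exists_mem_ge (hC : IsCSequence C) (h : α < β) : ∃ x ∈ C β, α ≤ x := by
  rcases eq_bot_or_covBy_or_isSuccLimit β with rfl | ⟨ξ, hξ⟩ | hβ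
  · exact (not_lt_bot h).elim
  · exact ⟨ξ, by simp [hC.succ _ _ hξ], le_of_not_gt fun h' => hξ.2 h' h⟩
  · exact hC.cofinal _ hβ _ h

theorem IsCSequence.finite_inter_Iio (hC : IsCSequence C) (h : α < β) : (C β ∩ Iio α).Finite := by
  rcases eq_bot_or_covBy_or_isSuccLimit β with rfl | ⟨ξ, hξ⟩ | hβ
  · exact (not_lt_bot h).elim
  · rw [hC.succ _ _ hξ]
    exact (finite_singleton ξ).inter_of_left _
  · obtain ⟨f⟩ := hC.orderType _ hβ
    obtain ⟨x, hx, hαx⟩ := hC.cofinal _ hβ _ h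
    refine ((finite_Iio (f.symm ⟨x, hx⟩)).image fun n => (f n : Omega1)).subset ?_
    rintro y ⟨hy, hyα⟩
    refine ⟨f.symm ⟨y, hy⟩, ?_, by simp⟩
    rw [mem_Iio, f.symm.lt_iff_lt]
    exact (show y < α from hyα).trans_le hαx

/-- The first step of the walk from `β` to `α`. -/
noncomputable def walkStep (C : Omega1 → Set Omega1) (α β : Omega1) : Omega1 :=
  sInf (C β \ Iio α)

theorem IsCSequence.walkStep_mem (hC : IsCSequence C) (h : α < β) :
    walkStep C α β ∈ C β \ Iio α := by
  obtain ⟨x, hx, hαx⟩ := hC.exists_mem_ge h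
  exact csInf_mem ⟨x, hx, not_lt.2 hαx⟩

theorem IsCSequence.le_walkStep (hC : IsCSequence C) (h : α < β) : α ≤ walkStep C α β :=
  not_lt.1 (hC.walkStep_mem h).2

theorem IsCSequence.walkStep_lt (hC : IsCSequence C) (h : α < β) : walkStep C α β < β :=
  hC.lt_of_mem (bot_le.trans_lt h) (hC.walkStep_mem h).1

theorem walk_succ' (i : ℕ) : walk C α β (i + 1) = walk C α (walkStep C α β) i := by
  induction i with
  | zero => rfl
  | succ i ih => rw [walk, ih, walk]

theorem IsCSequence.exists_walk_eq (hC : IsCSequence C) (h : α ≤ β) : ∃ i, walk C α β i = α := by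
  induction β using WellFoundedLT.induction with
  | ind β ih =>
    rcases h.eq_or_lt with rfl | h
    · exact ⟨0, rfl⟩
    · obtain ⟨i, hi⟩ := ih _ (hC.walkStep_lt h) (hC.le_walkStep h)
      exact ⟨i + 1, by rw [walk_succ', hi]⟩

theorem IsCSequence.walkLength_of_lt (hC : IsCSequence C) (h : α < β) :
    walkLength C α β = walkLength C α (walkStep C α β) + 1 := by
  have hne : ∃ i, i ∈ {i | walk C α (walkStep C α β) i = α} :=
    hC.exists_walk_eq (hC.le_walkStep h)
  have h0 : (0 : ℕ) ∉ {i | walk C α β i = α} := fun h' => h.ne' h'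
  have hset : {i | walk C α (walkStep C α β) i = α} = {i | i + 1 ∈ {i | walk C α β i = α}} := by
    ext i
    simp [walk_succ']
  have h1 : 0 < sInf {i | walk C α β i = α} := by
    rw [Nat.pos_iff_ne_zero]
    intro h'
    rcases Nat.sInf_eq_zero.1 h' with h' | h'
    · exact h0 h'
    · obtain ⟨i, hi⟩ := hC.exists_walk_eq h.le
      exact h'.subset hi
  rw [walkLength, walkLength, hset]
  exact (Nat.sInf_add (p := fun i => walk C α β i = α) h1).symm

theorem lowerPoint_le_iff {k : ℕ} {x : Omega1} :
    lowerPoint C α β k ≤ x ↔ ∀ j ≤ k, ∀ y ∈ C (walk C α β j), y < α → y ≤ x := by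
  rw [lowerPoint, csSup_le_iff']
  · simp only [mem_iUnion, mem_inter_iff, mem_Iio, exists_prop]
    exact ⟨fun h j hj y hy hyα => h y ⟨j, hj, hy, hyα⟩,
      fun h y ⟨j, hj, hy, hyα⟩ => h j hj y hy hyα⟩
  · refine ⟨α, fun y hy => ?_⟩
    simp only [mem_iUnion, mem_inter_iff, mem_Iio, exists_prop] at hy
    obtain ⟨j, hj, -, h⟩ := hy
    exact h.le

theorem lowerPoint_succ (k : ℕ) :
    lowerPoint C α β (k + 1) = max (lowerPoint C α β 0) (lowerPoint C α (walkStep C α β) k) := by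
  refine eq_of_forall_ge_iff fun x => ?_
  rw [max_le_iff, lowerPoint_le_iff, lowerPoint_le_iff, lowerPoint_le_iff]
  constructor
  · refine fun h => ⟨fun j hj => h j (by omega), fun j hj => ?_⟩
    rw [← walk_succ']
    exact h (j + 1) (by omega)
  · rintro ⟨h0, h1⟩ (_ | j) hj
    · exact h0 0 le_rfl
    · rw [walk_succ']
      exact h1 j (by omega)

theorem lowerPoint_zero_le_iff {x : Omega1} :
    lowerPoint C α β 0 ≤ x ↔ ∀ y ∈ C β, y < α → y ≤ x := by
  rw [lowerPoint_le_iff]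
  exact ⟨fun h => h 0 le_rfl, fun h j hj => by obtain rfl := Nat.le_zero.1 hj; exact h⟩

theorem lowerTrace_self : lowerTrace C α α = ∅ := by
  have : walkLength C α α = 0 := Nat.sInf_eq_zero.2 (.inl rfl)
  simp [lowerTrace, this]

/-- The recursion for the lower trace along the first step of the walk. -/
theorem IsCSequence.lowerTrace_of_lt (hC : IsCSequence C) (h : α < β) :
    lowerTrace C α β = insert (lowerPoint C α β 0)
      ((lowerTrace C α (walkStep C α β)).image fun ξ => max (lowerPoint C α β 0) ξ) := by
  ext x
  simp only [lowerTrace, hC.walkLength_of_lt h, Finset.mem_image, Finset.mem_range,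
    Finset.mem_insert]
  constructor
  · rintro ⟨_ | k, hk, rfl⟩
    · exact .inl rfl
    · exact .inr ⟨_, ⟨k, by omega, rfl⟩, (lowerPoint_succ k).symm⟩
  · rintro (rfl | ⟨_, ⟨k, hk, rfl⟩, rfl⟩)
    · exact ⟨0, by omega, rfl⟩
    · exact ⟨k + 1, by omega, lowerPoint_succ k⟩

theorem IsCSequence.lowerTrace_nonempty (hC : IsCSequence C) (h : α < β) :
    (lowerTrace C α β).Nonempty := by
  rw [hC.lowerTrace_of_lt h]
  exact Finset.insert_nonempty _ _

theorem le_of_mem_lowerTrace {x : Omega1} (hx : x ∈ lowerTrace C α β) : x ≤ α := by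
  obtain ⟨k, -, rfl⟩ := Finset.mem_image.1 hx
  exact lowerPoint_le_iff.2 fun _ _ _ _ h => h.le

theorem IsCSequence.lowerPoint_zero_le (hC : IsCSequence C) (h : α < β) {x : Omega1}
    (hx : x ∈ lowerTrace C α β) : lowerPoint C α β 0 ≤ x := by
  rw [hC.lowerTrace_of_lt h, Finset.mem_insert, Finset.mem_image] at hx
  rcases hx with rfl | ⟨y, -, rfl⟩
  · exact le_rfl
  · exact le_max_left _ _

theorem IsCSequence.lowerPoint_zero_lt (hC : IsCSequence C) (h : α < β) (hα : ⊥ < α) :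
    lowerPoint C α β 0 < α := by
  obtain h' | h' := (C β ∩ Iio α).eq_empty_or_nonempty
  · refine lt_of_le_of_lt (lowerPoint_zero_le_iff.2 fun y hy hyα => ?_) hα
    exact (h'.subset ⟨hy, hyα⟩).elim
  · obtain ⟨m, hm, hmax⟩ := (hC.finite_inter_Iio h).exists_maximal h'
    refine lt_of_le_of_lt (lowerPoint_zero_le_iff.2 fun y hy hyα => ?_) hm.2
    exact (le_total m y).elim (hmax ⟨hy, hyα⟩) id

theorem IsCSequence.lt_of_mem_lowerTrace (hC : IsCSequence C) (hα : ⊥ < α) (h : α ≤ β)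
    {x : Omega1} (hx : x ∈ lowerTrace C α β) : x < α := by
  induction β using WellFoundedLT.induction generalizing x with
  | ind β ih =>
    rcases h.eq_or_lt with rfl | h
    · simp [lowerTrace_self] at hx
    · rw [hC.lowerTrace_of_lt h, Finset.mem_insert, Finset.mem_image] at hx
      rcases hx with rfl | ⟨y, hy, rfl⟩
      · exact hC.lowerPoint_zero_lt h hα
      · exact max_lt (hC.lowerPoint_zero_lt h hα)
          (ih _ (hC.walkStep_lt h) (hC.le_walkStep h) hy)

/-- If `L(β,γ)` lies below `L(α,β)`, then the walk from `γ` to `α` passes through `β`, and its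
lower trace is the concatenation of the two traces. -/
theorem IsCSequence.lowerTrace_eq_union (hC : IsCSequence C) (hαβ : α < β) (hβγ : β ≤ γ)
    (h : ∀ x ∈ lowerTrace C β γ, ∀ y ∈ lowerTrace C α β, x < y) :
    lowerTrace C α γ = lowerTrace C β γ ∪ lowerTrace C α β := by
  induction γ using WellFoundedLT.induction with
  | ind γ ih =>
    rcases hβγ.eq_or_lt with rfl | hβγ
    · simp [lowerTrace_self]
    have hαγ := hαβ.trans hβγ
    have hlow : ∀ y ∈ lowerTrace C α β, lowerPoint C β γ 0 < y :=
      h _ (by rw [hC.lowerTrace_of_lt hβγ]; exact Finset.mem_insert_self _ _)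
    have hα : lowerPoint C β γ 0 < α := by
      obtain ⟨y, hy⟩ := hC.lowerTrace_nonempty hαβ
      exact (hlow y hy).trans_le (le_of_mem_lowerTrace hy)
    have hgap : ∀ x ∈ C γ, x < β → x < α := fun x hx hxβ =>
      (lowerPoint_zero_le_iff.1 le_rfl x hx hxβ).trans_lt hα
    have hpt : lowerPoint C α γ 0 = lowerPoint C β γ 0 := by
      refine eq_of_forall_ge_iff fun x => ?_
      rw [lowerPoint_zero_le_iff, lowerPoint_zero_le_iff]
      exact ⟨fun H y hy hyβ => H y hy (hgap y hy hyβ), fun H y hy hyα => H y hy (hyα.trans hαβ)⟩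
    have hstep : walkStep C α γ = walkStep C β γ := by
      have : C γ \ Iio α = C γ \ Iio β := by
        ext x
        simp only [mem_sdiff, mem_Iio, not_lt]
        refine and_congr_right fun hx => ⟨fun h' => ?_, hαβ.le.trans⟩
        exact le_of_not_gt fun hxβ => (hgap x hx hxβ).not_ge h'
      rw [walkStep, this, walkStep]
    have hrec := ih _ (hC.walkStep_lt hβγ) (hC.le_walkStep hβγ) (fun x hx y hy => by
      refine (le_max_right (lowerPoint C β γ 0) x).trans_lt (h _ ?_ y hy)
      rw [hC.lowerTrace_of_lt hβγ]
      exact Finset.mem_insert_of_mem (Finset.mem_image_of_mem _ hx))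
    rw [hC.lowerTrace_of_lt hαγ, hC.lowerTrace_of_lt hβγ, hpt, hstep, hrec, Finset.image_union,
      Finset.insert_union]
    congr 2
    conv_rhs => rw [← Finset.image_id (s := lowerTrace C α β)]
    exact Finset.image_congr fun y hy => max_eq_right (hlow y hy).le

/-- As `α` tends to a limit ordinal `δ`, so does `min L(α,δ)`. -/
theorem IsCSequence.exists_forall_lt_lowerTrace (hC : IsCSequence C) (hδ : Order.IsSuccLimit δ)
    (hγ : γ < δ) : ∃ ξ < δ, ∀ α, ξ < α → α < δ → ∀ x ∈ lowerTrace C α δ, γ < x := by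
  obtain ⟨γ', hγγ', hγ'⟩ := exists_lt_lt_of_isSuccLimit hδ hγ
  obtain ⟨ξ, hξ, hγξ⟩ := hC.exists_mem_ge hγ'
  refine ⟨ξ, hC.lt_of_mem (bot_lt_of_isSuccLimit hδ) hξ, fun α hξα hα x hx => ?_⟩
  exact (hγγ'.trans_le hγξ).trans_le
    ((lowerPoint_zero_le_iff.1 le_rfl ξ hξ hξα).trans (hC.lowerPoint_zero_le hα hx))

end Walks

/-! ### Counting oscillations on a union of two blocks -/

section Oscillation

variable {f g f' g' : Omega1 → ℕ} {L M : Finset Omega1} {ξ : Omega1}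

theorem mem_oscSet : ξ ∈ oscSet f g L ↔
    ξ ∈ L ∧ ∃ η, IsLeast {ζ | ζ ∈ L ∧ ξ < ζ} η ∧ f ξ ≤ g ξ ∧ g η < f η := by
  simp [oscSet]

theorem oscSet_congr (hf : ∀ x ∈ L, f x = f' x) (hg : ∀ x ∈ L, g x = g' x) :
    oscSet f g L = oscSet f' g' L := by
  ext ξ
  rw [mem_oscSet, mem_oscSet]
  refine and_congr_right fun hξ => exists_congr fun η => and_congr_right fun hη => ?_
  rw [hf _ hξ, hg _ hξ, hf _ hη.1.1, hg _ hη.1.1]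

theorem oscSet_eq_empty_of_forall_le (h : ∀ x ∈ L, f x ≤ g x) : oscSet f g L = ∅ := by
  ext ξ
  simp only [mem_oscSet, Finset.notMem_empty, iff_false]
  rintro ⟨-, η, hη, -, hlt⟩
  exact (h _ hη.1.1).not_gt hlt

theorem oscSet_eq_empty_of_forall_lt (h : ∀ x ∈ L, g x < f x) : oscSet f g L = ∅ := by
  ext ξ
  simp only [mem_oscSet, Finset.notMem_empty, iff_false]
  rintro ⟨hξ, η, -, hle, -⟩
  exact hle.not_gt (h _ hξ)

theorem exists_isGreatest_finset (hL : L.Nonempty) : ∃ ξ, IsGreatest (L : Set Omega1) ξ :=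
  ⟨_, L.isGreatest_max' hL⟩

theorem exists_isLeast_finset (hL : L.Nonempty) : ∃ ξ, IsLeast (L : Set Omega1) ξ :=
  ⟨_, L.isLeast_min' hL⟩

/-- Within a union of consecutive blocks, the only new oscillation can occur between the last
element of the first block and the first element of the second. -/
theorem mem_oscSet_union (h : ∀ x ∈ L, ∀ y ∈ M, x < y) :
    ξ ∈ oscSet f g (L ∪ M) ↔ ξ ∈ oscSet f g L ∨ ξ ∈ oscSet f g M ∨
      (IsGreatest (L : Set Omega1) ξ ∧
        ∃ η, IsLeast (M : Set Omega1) η ∧ f ξ ≤ g ξ ∧ g η < f η) := by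
  simp only [mem_oscSet, Finset.mem_union]
  constructor
  · rintro ⟨hξ | hξ, η, ⟨⟨hη, hξη⟩, hmin⟩, hle, hlt⟩
    · rcases hη with hη | hη
      · exact .inl ⟨hξ, η, ⟨⟨hη, hξη⟩, fun ζ hζ => hmin ⟨.inl hζ.1, hζ.2⟩⟩, hle, hlt⟩
      · refine .inr (.inr ⟨⟨hξ, fun ζ hζ => ?_⟩, η, ⟨hη, fun ζ hζ => hmin ⟨.inr hζ, h _ hξ _ hζ⟩⟩,
          hle, hlt⟩)
        by_contra hlt'
        exact (hmin ⟨.inl hζ, not_le.1 hlt'⟩).not_gt (h _ hζ _ hη)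
    · rcases hη with hη | hη
      · exact ((h _ hη _ hξ).trans hξη).false.elim
      · exact .inr (.inl ⟨hξ, η, ⟨⟨hη, hξη⟩, fun ζ hζ => hmin ⟨.inr hζ.1, hζ.2⟩⟩, hle, hlt⟩)
  · rintro (⟨hξ, η, ⟨⟨hη, hξη⟩, hmin⟩, hle, hlt⟩ | ⟨hξ, η, ⟨⟨hη, hξη⟩, hmin⟩, hle, hlt⟩ |
      ⟨hξ, η, hη, hle, hlt⟩)
    · refine ⟨.inl hξ, η, ⟨⟨.inl hη, hξη⟩, ?_⟩, hle, hlt⟩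
      rintro ζ ⟨hζ | hζ, hξζ⟩
      · exact hmin ⟨hζ, hξζ⟩
      · exact (h _ hη _ hζ).le
    · refine ⟨.inr hξ, η, ⟨⟨.inr hη, hξη⟩, ?_⟩, hle, hlt⟩
      rintro ζ ⟨hζ | hζ, hξζ⟩
      · exact ((h _ hζ _ hξ).trans hξζ).false.elim
      · exact hmin ⟨hζ, hξζ⟩
    · refine ⟨.inl hξ.1, η, ⟨⟨.inr hη.1, h _ hξ.1 _ hη.1⟩, ?_⟩, hle, hlt⟩
      rintro ζ ⟨hζ | hζ, hξζ⟩
      · exact ((hξ.2 hζ).not_gt hξζ).elim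
      · exact hη.2 hζ

theorem card_oscSet_union (h : ∀ x ∈ L, ∀ y ∈ M, x < y)
    (hno : ∀ ξ η, IsGreatest (L : Set Omega1) ξ → IsLeast (M : Set Omega1) η → f ξ ≤ g ξ →
      f η ≤ g η) :
    (oscSet f g (L ∪ M)).card = (oscSet f g L).card + (oscSet f g M).card := by
  classical
  rw [← Finset.card_union_of_disjoint]
  · congr 1
    ext ξ
    rw [mem_oscSet_union h, Finset.mem_union]
    refine or_congr_right (or_iff_left ?_)
    rintro ⟨hξ, η, hη, hle, hlt⟩
    exact (hno ξ η hξ hη hle).not_gt hlt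
  · rw [Finset.disjoint_left]
    exact fun x hx hx' => (h x (mem_oscSet.1 hx).1 x (mem_oscSet.1 hx').1).false

theorem card_oscSet_union_eq_one (h : ∀ x ∈ L, ∀ y ∈ M, x < y) (hL : L.Nonempty)
    (hM : M.Nonempty) (hLe : ∀ x ∈ L, f x ≤ g x) (hLt : ∀ x ∈ M, g x < f x) :
    (oscSet f g (L ∪ M)).card = 1 := by
  rw [Finset.card_eq_one]
  obtain ⟨m, hm⟩ := exists_isGreatest_finset hL
  obtain ⟨η, hη⟩ := exists_isLeast_finset hM
  refine ⟨m, Finset.ext fun ξ => ?_⟩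
  rw [mem_oscSet_union h, oscSet_eq_empty_of_forall_le hLe, oscSet_eq_empty_of_forall_lt hLt,
    Finset.mem_singleton]
  simp only [Finset.notMem_empty, false_or]
  constructor
  · rintro ⟨hξ, -⟩
    exact hξ.unique hm
  · rintro rfl
    exact ⟨hm, η, hη, hLe _ hm.1, hLt _ hη.1⟩

end Oscillation

/-! ### Unbounded families and reflecting ordinals -/

section Families

variable {C : Omega1 → Set Omega1} {e : Omega1 → Omega1 → ℕ} {ι : Type*}
  {A : Set (ι → Omega1)} {B : Set Omega1} {δ : Omega1}

/-- A family of tuples in `ω₁` that has, above each ordinal, a member all of whose entries exceed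
that ordinal; uncountable families of pairwise disjoint tuples are of this kind. -/
def IsUnboundedFamily (A : Set (ι → Omega1)) : Prop :=
  ∀ δ, ∃ a ∈ A, ∀ i, δ < a i

theorem IsUnboundedFamily.exists_of_iUnion {κ : Type*} [Countable κ] {D : κ → Set (ι → Omega1)}
    (hA : IsUnboundedFamily A) (h : ∀ a ∈ A, ∃ k, a ∈ D k) :
    ∃ k, IsUnboundedFamily (A ∩ D k) := by
  by_contra! hc
  simp only [IsUnboundedFamily, not_forall, not_exists, not_and] at hc
  choose ρ hρ using hc
  obtain ⟨δ, hδ⟩ := exists_forall_lt ρ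
  obtain ⟨a, ha, haδ⟩ := hA δ
  obtain ⟨k, hk⟩ := h a ha
  obtain ⟨i, hi⟩ := hρ k a ⟨ha, hk⟩
  exact hi ((hδ k).trans (haδ i))

theorem exists_lt_forall_le_of_finite {S : Set Omega1} (hδ : ⊥ < δ) (hS : S.Finite)
    (h : ∀ x ∈ S, x < δ) : ∃ γ < δ, ∀ x ∈ S, x ≤ γ := by
  refine ⟨hS.toFinset.sup id, (Finset.sup_lt_iff hδ).2 fun x hx => h x (by simpa using hx),
    fun x hx => Finset.le_sup (f := id) (by simpa using hx)⟩

/-- Beyond some ordinal `ρ`, the functions `e_α` with `α` in the tuples of an unbounded family can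
be made simultaneously large on any finite set: for each bound `n`, the sets on which this fails
cannot be found arbitrarily high, as infinitely many consecutive ones would violate
finite-to-oneness. -/
theorem IsCoherentFiniteToOne.exists_large [Finite ι] (he : IsCoherentFiniteToOne e)
    (hA : IsUnboundedFamily A) :
    ∃ ρ, ∀ (n : ℕ) (L : Finset Omega1), (∀ x ∈ L, ρ ≤ x) → ∀ δ, ∃ a ∈ A, (∀ i, δ < a i) ∧
      ∀ i, ∀ x ∈ L, n < e (a i) x := by
  suffices H : ∀ n : ℕ, ∃ ρ, ∀ L : Finset Omega1, (∀ x ∈ L, ρ ≤ x) → ∀ δ, ∃ a ∈ A,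
      (∀ i, δ < a i) ∧ ∀ i, ∀ x ∈ L, n < e (a i) x by
    choose ρ hρ using H
    obtain ⟨ρ', h⟩ := exists_forall_lt ρ
    exact ⟨ρ', fun n L hL => hρ n L fun x hx => (h n).le.trans (hL x hx)⟩
  intro n
  by_contra! hc
  choose L hL δ hδ using hc
  have step : ∀ ρ, ∃ ρ', ρ < ρ' ∧ ∀ x ∈ L ρ, x < ρ' := by
    intro ρ
    obtain ⟨ρ', h⟩ := exists_forall_lt_of_countable ((L ρ).countable_toSet.insert ρ)
    exact ⟨ρ', h _ (mem_insert _ _), fun x hx => h _ (mem_insert_of_mem _ hx)⟩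
  choose g hg hgL using step
  set s : ℕ → Omega1 := fun n => g^[n] ⊥ with hs
  have hsucc : ∀ n, s (n + 1) = g (s n) := fun n => by simp [hs, Function.iterate_succ_apply']
  obtain ⟨ζ, hζ⟩ := exists_forall_lt fun m => max (s (m + 1)) (δ (s m))
  obtain ⟨a, ha, haζ⟩ := hA ζ
  have hex : ∀ m, ∃ i, ∃ x ∈ L (s m), e (a i) x ≤ n := fun m =>
    hδ (s m) a ha fun i => ((le_max_right _ _).trans_lt (hζ m)).trans (haζ i)
  choose i x hxL hxe using hex
  have hlt : ∀ m, x m < s (m + 1) := fun m => hsucc m ▸ hgL _ _ (hxL m)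
  have hx : StrictMono x := strictMono_nat_of_lt_succ fun m =>
    (hlt m).trans_le (hL _ _ (hxL (m + 1)))
  refine infinite_range_of_injective hx.injective ((finite_iUnion fun i : ι =>
    (finite_Iic n).biUnion fun m _ => he.finiteToOne (a i) m).subset ?_)
  rintro _ ⟨m, rfl⟩
  refine mem_iUnion.2 ⟨i m, mem_biUnion (hxe m) ⟨?_, rfl⟩⟩
  exact (hlt m).trans (((le_max_left _ _).trans_lt (hζ m)).trans (haζ _))

/-- The tuples `a ∈ A` such that each `e_{a(i)}` restricts to `φ i` on the finite set `K`. -/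
def agreeing (e : Omega1 → Omega1 → ℕ) (A : Set (ι → Omega1)) (K : Finset Omega1)
    (φ : ι → K → ℕ) : Set (ι → Omega1) :=
  {a ∈ A | ∀ i, ∀ x : K, e (a i) x = φ i x}

/-- The ordinals `δ` below tuples `a ∈ A` and `b ∈ B` with prescribed finite restrictions and
prescribed `L(δ,b)`, such that above `γ` the functions `e_{a(i)}` and `e_b` agree with `e_δ`, and
such that `L(α,δ)` lies above `γ` for all `α` between `θ` and `δ`. -/
def similar (C : Omega1 → Set Omega1) (e : Omega1 → Omega1 → ℕ) (A : Set (ι → Omega1))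
    (B : Set Omega1) (K : Finset Omega1) (φ : ι → K → ℕ) (ψ : K → ℕ) (L : Finset Omega1)
    (γ θ : Omega1) : Set Omega1 :=
  {δ | (∃ a ∈ agreeing e A K φ, (∀ i, δ < a i) ∧
          ∀ i x, γ < x → x < δ → e (a i) x = e δ x) ∧
        (∃ b ∈ B, (∀ x : K, e b x = ψ x) ∧ δ < b ∧ lowerTrace C δ b = L ∧
          ∀ x, γ < x → x < δ → e b x = e δ x) ∧
        ∀ α, θ < α → α < δ → ∀ x ∈ lowerTrace C α δ, γ < x}

/-- A limit ordinal `δ` at which everything needed of the trace on `ω₁` of a countable elementary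
submodel containing `C`, `e`, `A` and `B` holds. -/
structure IsReflecting (C : Omega1 → Set Omega1) (e : Omega1 → Omega1 → ℕ) (A : Set (ι → Omega1))
    (B : Set Omega1) (δ : Omega1) : Prop where
  isSuccLimit : Order.IsSuccLimit δ
  unbounded : ∀ K : Finset Omega1, (∀ x ∈ K, x < δ) → ∀ φ : ι → K → ℕ, ∀ a ∈ agreeing e A K φ,
    (∀ i, δ < a i) → IsUnboundedFamily (agreeing e A K φ)
  exists_below : ∀ K : Finset Omega1, (∀ x ∈ K, x < δ) → ∀ φ : ι → K → ℕ,
    IsUnboundedFamily (agreeing e A K φ) → ∀ γ < δ, ∃ a ∈ agreeing e A K φ, ∀ i, γ < a i ∧ a i < δ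
  large : ∀ K : Finset Omega1, (∀ x ∈ K, x < δ) → ∀ φ : ι → K → ℕ,
    IsUnboundedFamily (agreeing e A K φ) → ∃ ρ < δ, ∀ (n : ℕ) (L : Finset Omega1),
      (∀ x ∈ L, ρ ≤ x) → ∀ δ', ∃ a ∈ agreeing e A K φ, (∀ i, δ' < a i) ∧
        ∀ i, ∀ x ∈ L, n < e (a i) x
  exists_similar : ∀ K : Finset Omega1, (∀ x ∈ K, x < δ) → ∀ φ ψ L γ θ, (∀ x ∈ L, x < δ) → γ < δ →
    θ < δ → δ ∈ similar (ι := ι) C e A B K φ ψ L γ θ →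
    ∃ δ' ∈ similar C e A B K φ ψ L γ θ, δ < δ'

theorem countable_setOf_finset_lt (δ : Omega1) :
    {K : Finset Omega1 | ∀ x ∈ K, x < δ}.Countable := by
  have := (countable_Iio δ).to_subtype
  refine (countable_range fun K : Finset (Iio δ) => K.map (Function.Embedding.subtype _)).mono ?_
  intro K hK
  refine ⟨K.subtype (· ∈ Iio δ), ?_⟩
  ext x
  simp only [Finset.mem_map, Finset.mem_subtype]
  exact ⟨by rintro ⟨y, hy, rfl⟩; exact hy, fun hx => ⟨⟨x, hK x hx⟩, hx, rfl⟩⟩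

theorem exists_isReflecting [Finite ι] (he : IsCoherentFiniteToOne e) :
    ∃ δ, IsReflecting C e A B δ := by
  let P := Σ K : Finset Omega1,
    (ι → K → ℕ) × (K → ℕ) × Finset Omega1 × Omega1 × Omega1
  let r : P → Omega1 := fun p =>
    (p.1.sup id) ⊔ ((p.2.2.2.1.sup id) ⊔ (p.2.2.2.2.1 ⊔ p.2.2.2.2.2))
  have hr : ∀ δ, {p | r p < δ}.Countable := by
    intro δ
    rcases eq_or_ne δ ⊥ with rfl | hδ
    · simp
    have hδ := bot_lt_iff_ne_bot.2 hδ
    have := (countable_Iio δ).to_subtype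
    have := (countable_setOf_finset_lt δ).to_subtype
    refine (countable_range fun q : Σ K : {K : Finset Omega1 | ∀ x ∈ K, x < δ},
      (ι → K.1 → ℕ) × (K.1 → ℕ) × {K : Finset Omega1 | ∀ x ∈ K, x < δ} × Iio δ × Iio δ =>
      (⟨q.1.1, q.2.1, q.2.2.1, q.2.2.2.1.1, q.2.2.2.2.1.1, q.2.2.2.2.2.1⟩ : P)).mono ?_
    rintro ⟨K, φ, ψ, L, γ, θ⟩ hp
    have hp : (K.sup id) ⊔ ((L.sup id) ⊔ (γ ⊔ θ)) < δ := hp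
    simp only [sup_lt_iff, Finset.sup_lt_iff hδ, id] at hp
    exact ⟨⟨⟨K, hp.1⟩, φ, ψ, ⟨L, hp.2.1⟩, ⟨γ, hp.2.2.1⟩, ⟨θ, hp.2.2.2⟩⟩, rfl⟩
  have hunb : ∀ p : P, ∃ ρ, IsUnboundedFamily (agreeing e A p.1 p.2.1) ∨
      ∀ a ∈ agreeing e A p.1 p.2.1, ¬ ∀ i, ρ < a i := by
    intro p
    by_cases h : IsUnboundedFamily (agreeing e A p.1 p.2.1)
    · exact ⟨⊥, .inl h⟩
    · simp only [IsUnboundedFamily, not_forall, not_exists, not_and] at h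
      obtain ⟨ρ, hρ⟩ := h
      exact ⟨ρ, .inr fun a ha h' => (hρ a ha).elim fun i hi => hi (h' i)⟩
  have hbel : ∀ p : P, ∃ ρ, IsUnboundedFamily (agreeing e A p.1 p.2.1) →
      ∃ a ∈ agreeing e A p.1 p.2.1, ∀ i, p.2.2.2.2.1 < a i ∧ a i < ρ := by
    intro p
    by_cases h : IsUnboundedFamily (agreeing e A p.1 p.2.1)
    · obtain ⟨a, ha, haγ⟩ := h p.2.2.2.2.1
      obtain ⟨ρ, hρ⟩ := exists_forall_lt a
      exact ⟨ρ, fun _ => ⟨a, ha, fun i => ⟨haγ i, hρ i⟩⟩⟩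
    · exact ⟨⊥, fun h' => (h h').elim⟩
  have hlar : ∀ p : P, ∃ ρ, IsUnboundedFamily (agreeing e A p.1 p.2.1) →
      ∀ (n : ℕ) (L : Finset Omega1), (∀ x ∈ L, ρ ≤ x) → ∀ δ', ∃ a ∈ agreeing e A p.1 p.2.1,
        (∀ i, δ' < a i) ∧ ∀ i, ∀ x ∈ L, n < e (a i) x := by
    intro p
    by_cases h : IsUnboundedFamily (agreeing e A p.1 p.2.1)
    · exact (he.exists_large h).imp fun ρ hρ _ => hρ
    · exact ⟨⊥, fun h' => (h h').elim⟩
  have hsim : ∀ p : P, ∃ ρ, ∀ δ ∈ similar C e A B p.1 p.2.1 p.2.2.1 p.2.2.2.1 p.2.2.2.2.1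
      p.2.2.2.2.2, (∃ δ' ∈ similar C e A B p.1 p.2.1 p.2.2.1 p.2.2.2.1 p.2.2.2.2.1 p.2.2.2.2.2,
        δ < δ') ∨ δ ≤ ρ := by
    intro p
    by_cases h : ∃ δ ∈ similar C e A B p.1 p.2.1 p.2.2.1 p.2.2.2.1 p.2.2.2.2.1 p.2.2.2.2.2,
      ∀ δ' ∈ similar C e A B p.1 p.2.1 p.2.2.1 p.2.2.2.1 p.2.2.2.2.1 p.2.2.2.2.2, δ' ≤ δ
    · obtain ⟨ρ, -, hρ⟩ := h
      exact ⟨ρ, fun δ hδ => .inr (hρ δ hδ)⟩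
    · push Not at h
      exact ⟨⊥, fun δ hδ => .inl (h δ hδ)⟩
  choose F₁ hF₁ using hunb
  choose F₂ hF₂ using hbel
  choose F₃ hF₃ using hlar
  choose F₄ hF₄ using hsim
  obtain ⟨δ, hδ, hF⟩ :=
    exists_isSuccLimit_forall_lt r (fun p => (F₁ p ⊔ F₂ p) ⊔ (F₃ p ⊔ F₄ p)) hr
  have hbot := bot_lt_of_isSuccLimit hδ
  have hF' : ∀ (K : Finset Omega1) φ ψ (L : Finset Omega1) γ θ, (∀ x ∈ K, x < δ) →
      (∀ x ∈ L, x < δ) → γ < δ → θ < δ → ∀ p : P, p = ⟨K, φ, ψ, L, γ, θ⟩ →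
      (F₁ p < δ ∧ F₂ p < δ) ∧ (F₃ p < δ ∧ F₄ p < δ) := by
    rintro K φ ψ L γ θ hK hL hγ hθ p rfl
    have := hF ⟨K, φ, ψ, L, γ, θ⟩ (by
      change (K.sup id) ⊔ ((L.sup id) ⊔ (γ ⊔ θ)) < δ
      simp only [sup_lt_iff, Finset.sup_lt_iff hbot, id]
      exact ⟨hK, hL, hγ, hθ⟩)
    simpa only [sup_lt_iff] using this
  refine ⟨δ, hδ, ?_, ?_, ?_, ?_⟩
  · intro K hK φ a ha hδa
    obtain ⟨⟨h, -⟩, -⟩ := hF' K φ 0 ∅ ⊥ ⊥ hK (by simp) hbot hbot _ rfl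
    exact (hF₁ ⟨K, φ, 0, ∅, ⊥, ⊥⟩).resolve_right fun h' => h' a ha fun i => h.trans (hδa i)
  · intro K hK φ hunb γ hγ
    obtain ⟨⟨-, h⟩, -⟩ := hF' K φ 0 ∅ γ ⊥ hK (by simp) hγ hbot _ rfl
    obtain ⟨a, ha, h'⟩ := hF₂ ⟨K, φ, 0, ∅, γ, ⊥⟩ hunb
    exact ⟨a, ha, fun i => ⟨(h' i).1, (h' i).2.trans h⟩⟩
  · intro K hK φ hunb
    obtain ⟨-, h, -⟩ := hF' K φ 0 ∅ ⊥ ⊥ hK (by simp) hbot hbot _ rfl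
    exact ⟨_, h, hF₃ ⟨K, φ, 0, ∅, ⊥, ⊥⟩ hunb⟩
  · intro K hK φ ψ L γ θ hL hγ hθ hmem
    obtain ⟨-, -, h⟩ := hF' K φ ψ L γ θ hK hL hγ hθ _ rfl
    exact (hF₄ ⟨K, φ, ψ, L, γ, θ⟩ δ hmem).resolve_right h.not_ge

end Families

/-! ### Prescribing oscillations -/

section EndExtension

variable {C : Omega1 → Set Omega1} {e : Omega1 → Omega1 → ℕ} {ι : Type*}
  {A : Set (ι → Omega1)} {B : Set Omega1} {δ : Omega1}

/-- At a reflecting ordinal `δ`, a pair `a`, `b` above `δ` can be replaced by one that looks the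
same on a given finite set `K`, while `L(δ,b)` is end-extended by a nonempty block `M` on which
the functions of the new tuple either all agree with, or all exceed, that of the new ordinal. -/
theorem IsReflecting.exists_end_extension [Finite ι] (hC : IsCSequence C)
    (he : IsCoherentFiniteToOne e) (hδ : IsReflecting C e A B δ) {K : Finset Omega1}
    (hK : ∀ x ∈ K, x < δ) {a : ι → Omega1} (ha : a ∈ A) (haδ : ∀ i, δ < a i) {b : Omega1}
    (hb : b ∈ B) (hbδ : δ < b) :
    ∃ b' ∈ B, δ < b' ∧ (∀ x ∈ K, e b' x = e b x) ∧ ∃ M : Finset Omega1, M.Nonempty ∧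
      (∀ x ∈ M, x < δ) ∧ (∀ x ∈ K ∪ lowerTrace C δ b, ∀ y ∈ M, x < y) ∧
      lowerTrace C δ b' = lowerTrace C δ b ∪ M ∧
      (∃ a' ∈ A, (∀ i, δ < a' i) ∧ (∀ i, ∀ x ∈ K, e (a' i) x = e (a i) x) ∧
        ∀ i, ∀ x ∈ M, e (a' i) x = e b' x) ∧
      (∃ a' ∈ A, (∀ i, δ < a' i) ∧ (∀ i, ∀ x ∈ K, e (a' i) x = e (a i) x) ∧
        ∀ i, ∀ x ∈ M, e b' x < e (a' i) x) := by
  have hlim := hδ.isSuccLimit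
  have hbot := bot_lt_of_isSuccLimit hlim
  set φ : ι → K → ℕ := fun i x => e (a i) x with hφ
  have haφ : a ∈ agreeing e A K φ := ⟨ha, fun _ _ => rfl⟩
  have hunb := hδ.unbounded K hK φ a haφ haδ
  obtain ⟨ρ, hρδ, hρ⟩ := hδ.large K hK φ hunb
  have hLδ : ∀ x ∈ lowerTrace C δ b, x < δ := fun x hx => hC.lt_of_mem_lowerTrace hbot hbδ.le hx
  -- Above `γ < δ` all functions involved agree with `e δ`, and values can be prescribed large.
  obtain ⟨γ, hγδ, hγ⟩ : ∃ γ < δ, ∀ x ∈ insert ρ ((K : Set Omega1) ∪ lowerTrace C δ b ∪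
      ((⋃ i, {x | x < δ ∧ e (a i) x ≠ e δ x}) ∪ {x | x < δ ∧ e b x ≠ e δ x})), x ≤ γ := by
    refine exists_lt_forall_le_of_finite hbot (((K.finite_toSet.union (Finset.finite_toSet _)).union
      ((finite_iUnion fun i => he.coherent _ _ (haδ i)).union
        (he.coherent _ _ hbδ))).insert ρ) ?_
    rintro x (rfl | (hx | hx) | hx | hx)
    · exact hρδ
    · exact hK x hx
    · exact hLδ x hx
    · exact (mem_iUnion.1 hx).elim fun i hi => hi.1
    · exact hx.1
  obtain ⟨θ, hθδ, hθ⟩ := hC.exists_forall_lt_lowerTrace hlim hγδ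
  have hmem : δ ∈ similar C e A B K φ (fun x => e b x) (lowerTrace C δ b) γ θ := by
    refine ⟨⟨a, haφ, haδ, fun i x hγx hxδ => ?_⟩, ⟨b, hb, fun _ => rfl, hbδ, rfl,
      fun x hγx hxδ => ?_⟩, hθ⟩
    · by_contra hne
      exact (hγ x (.inr (.inr (.inl (mem_iUnion.2 ⟨i, hxδ, hne⟩))))).not_gt hγx
    · by_contra hne
      exact (hγ x (.inr (.inr (.inr ⟨hxδ, hne⟩)))).not_gt hγx
  obtain ⟨δ', ⟨⟨a', ha', haδ', hae⟩, ⟨b', hb', hbe, hbδ', hL, hbe'⟩, hlow⟩, hδδ'⟩ :=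
    hδ.exists_similar K hK _ _ _ _ _ hLδ hγδ hθδ hmem
  have hMγ : ∀ x ∈ lowerTrace C δ δ', γ < x := hlow δ hθδ hδδ'
  have hMδ : ∀ x ∈ lowerTrace C δ δ', x < δ := fun x hx =>
    hC.lt_of_mem_lowerTrace hbot hδδ'.le hx
  have hlt : ∀ x ∈ K ∪ lowerTrace C δ b, ∀ y ∈ lowerTrace C δ δ', x < y := by
    intro x hx y hy
    refine (hγ x (.inr (.inl ?_))).trans_lt (hMγ y hy)
    simpa using hx
  refine ⟨b', hb', hδδ'.trans hbδ', fun x hx => hbe ⟨x, hx⟩, lowerTrace C δ δ',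
    hC.lowerTrace_nonempty hδδ', hMδ, hlt, ?_, ?_, ?_⟩
  · rw [← hL]
    exact hC.lowerTrace_eq_union hδδ' hbδ'.le fun x hx y hy =>
      hlt x (Finset.mem_union_right _ (hL ▸ hx)) y hy
  · refine ⟨a', ha'.1, fun i => hδδ'.trans (haδ' i), fun i x hx => ha'.2 i ⟨x, hx⟩,
      fun i x hx => ?_⟩
    have hxδ' := (hMδ x hx).trans hδδ'
    rw [hae i x (hMγ x hx) hxδ', hbe' x (hMγ x hx) hxδ']
  · obtain ⟨a'', ha'', haδ'', hn⟩ := hρ ((lowerTrace C δ δ').sup (e b')) (lowerTrace C δ δ')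
      (fun x hx => (hγ ρ (.inl rfl)).trans (hMγ x hx).le) δ
    exact ⟨a'', ha''.1, haδ'', fun i x hx => ha''.2 i ⟨x, hx⟩,
      fun i x hx => (Finset.le_sup hx).trans_lt (hn i x hx)⟩

/-- Two end-extensions, first by a block of equality and then by a block where `e_{a(i)}` is
larger, add exactly one oscillation. -/
theorem IsReflecting.exists_card_oscSet_succ [Finite ι] (hC : IsCSequence C)
    (he : IsCoherentFiniteToOne e) (hδ : IsReflecting C e A B δ) {K : Finset Omega1}
    (hK : ∀ x ∈ K, x < δ) {a : ι → Omega1} (ha : a ∈ A) (haδ : ∀ i, δ < a i) {b : Omega1}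
    (hb : b ∈ B) (hbδ : δ < b) (hLK : lowerTrace C δ b ⊆ K) :
    ∃ K' : Finset Omega1, K ⊆ K' ∧ (∀ x ∈ K', x < δ) ∧
      ∃ a' ∈ A, (∀ i, δ < a' i) ∧ (∀ i, ∀ x ∈ K, e (a' i) x = e (a i) x) ∧
      ∃ b' ∈ B, δ < b' ∧ lowerTrace C δ b' ⊆ K' ∧
      (∀ i, ∀ ξ, IsGreatest (lowerTrace C δ b' : Set Omega1) ξ → e b' ξ < e (a' i) ξ) ∧
      ∀ i, (oscSet (e (a' i)) (e b') (lowerTrace C δ b')).card =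
        (oscSet (e (a i)) (e b) (lowerTrace C δ b)).card + 1 := by
  obtain ⟨b₁, hb₁, hbδ₁, hbe₁, M₁, hM₁, hMδ₁, hlt₁, hL₁, ⟨a₁, ha₁, haδ₁, hae₁, hav₁⟩, -⟩ :=
    hδ.exists_end_extension hC he hK ha haδ hb hbδ
  have hK₁ : ∀ x ∈ K ∪ M₁, x < δ := fun x hx =>
    (Finset.mem_union.1 hx).elim (hK x) (hMδ₁ x)
  obtain ⟨b₂, hb₂, hbδ₂, hbe₂, M₂, hM₂, hMδ₂, hlt₂, hL₂, -, ⟨a₂, ha₂, haδ₂, hae₂, hav₂⟩⟩ :=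
    hδ.exists_end_extension hC he hK₁ ha₁ haδ₁ hb₁ hbδ₁
  have hlt₂' : ∀ x ∈ K ∪ M₁, ∀ y ∈ M₂, x < y := fun x hx => hlt₂ x (Finset.mem_union_left _ hx)
  have hL : lowerTrace C δ b₂ = lowerTrace C δ b ∪ (M₁ ∪ M₂) := by
    rw [hL₂, hL₁, Finset.union_assoc]
  refine ⟨K ∪ M₁ ∪ M₂, fun x hx => by simp [hx], fun x hx =>
    (Finset.mem_union.1 hx).elim (hK₁ x) (hMδ₂ x), a₂, ha₂, haδ₂, fun i x hx => ?_,
    b₂, hb₂, hbδ₂, ?_, fun i ξ hξ => ?_, fun i => ?_⟩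
  · rw [hae₂ i x (Finset.mem_union_left _ hx), hae₁ i x hx]
  · rw [hL, Finset.union_assoc]
    exact Finset.union_subset_union hLK subset_rfl
  · have hξ' : ξ ∈ lowerTrace C δ b₁ ∪ M₂ := hL₂ ▸ hξ.1
    rcases Finset.mem_union.1 hξ' with h | h
    · obtain ⟨y, hy⟩ := hM₂
      have hy' : y ∈ (lowerTrace C δ b₂ : Set Omega1) := by simp [hL₂, hy]
      exact ((hlt₂ ξ (Finset.mem_union_right _ h) y hy).not_ge (hξ.2 hy')).elim
    · exact hav₂ i ξ h
  · have heq : ∀ x ∈ M₁, e (a₂ i) x = e b₂ x := fun x hx => by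
      rw [hae₂ i x (Finset.mem_union_right _ hx), hbe₂ x (Finset.mem_union_right _ hx),
        hav₁ i x hx]
    rw [hL, card_oscSet_union]
    · rw [card_oscSet_union_eq_one (fun x hx => hlt₂' x (Finset.mem_union_right _ hx)) hM₁ hM₂
        (fun x hx => (heq x hx).le) (hav₂ i)]
      congr 2
      refine oscSet_congr (fun x hx => ?_) (fun x hx => ?_)
      · rw [hae₂ i x (Finset.mem_union_left _ (hLK hx)), hae₁ i x (hLK hx)]
      · rw [hbe₂ x (Finset.mem_union_left _ (hLK hx)), hbe₁ x (hLK hx)]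
    · intro x hx y hy
      rcases Finset.mem_union.1 hy with h | h
      · exact hlt₁ x (Finset.mem_union_right _ hx) y h
      · exact hlt₂' x (Finset.mem_union_left _ (hLK hx)) y h
    · intro ξ η _ hη _
      rcases Finset.mem_union.1 hη.1 with h | h
      · exact (heq η h).le
      · obtain ⟨y, hy⟩ := hM₁
        have hy' : y ∈ ((M₁ ∪ M₂ : Finset Omega1) : Set Omega1) := by simp [hy]
        exact ((hlt₂' y (Finset.mem_union_right _ hy) η h).not_ge (hη.2 hy')).elim

theorem IsReflecting.exists_card_oscSet_eq_add [Finite ι] (hC : IsCSequence C)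
    (he : IsCoherentFiniteToOne e) (hδ : IsReflecting C e A B δ) (hA : IsUnboundedFamily A)
    (hB : ¬ B.Countable) (n : ℕ) :
    ∃ K : Finset Omega1, (∀ x ∈ K, x < δ) ∧ ∃ a ∈ A, (∀ i, δ < a i) ∧ ∃ b : ℕ → Omega1,
      ∀ m ≤ n, b m ∈ B ∧ δ < b m ∧ lowerTrace C δ (b m) ⊆ K ∧
      (∀ i, ∀ ξ, IsGreatest (lowerTrace C δ (b m) : Set Omega1) ξ → e (b m) ξ < e (a i) ξ) ∧
      ∀ i, (oscSet (e (a i)) (e (b m)) (lowerTrace C δ (b m))).card =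
        (oscSet (e (a i)) (e (b 0)) (lowerTrace C δ (b 0))).card + m := by
  induction n with
  | zero =>
    obtain ⟨a, ha, haδ⟩ := hA δ
    obtain ⟨b, hb, hbδ⟩ := not_countable_iff.1 hB δ
    have hLδ : ∀ x ∈ lowerTrace C δ b, x < δ := fun x hx =>
      hC.lt_of_mem_lowerTrace (bot_lt_of_isSuccLimit hδ.isSuccLimit) hbδ.le hx
    obtain ⟨K, -, hK, a', ha', haδ', -, b', hb', hbδ', hLK, hgr, -⟩ :=
      hδ.exists_card_oscSet_succ hC he hLδ ha haδ hb hbδ subset_rfl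
    refine ⟨K, hK, a', ha', haδ', fun _ => b', fun m hm => ⟨hb', hbδ', hLK, hgr, ?_⟩⟩
    simp [Nat.le_zero.1 hm]
  | succ n ih =>
    obtain ⟨K, hK, a, ha, haδ, b, hb⟩ := ih
    obtain ⟨hbB, hbδ, hbK, -, hosc⟩ := hb n le_rfl
    obtain ⟨K', hKK', hK', a', ha', haδ', hae, b', hb', hbδ', hLK, hgr, hosc'⟩ :=
      hδ.exists_card_oscSet_succ hC he hK ha haδ hbB hbδ hbK
    have hcongr : ∀ m ≤ n, ∀ i, oscSet (e (a' i)) (e (b m)) (lowerTrace C δ (b m)) =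
        oscSet (e (a i)) (e (b m)) (lowerTrace C δ (b m)) := fun m hm i =>
      oscSet_congr (fun x hx => hae i x ((hb m hm).2.2.1 hx)) fun _ _ => rfl
    refine ⟨K', hK', a', ha', haδ', Function.update b (n + 1) b', fun m hm => ?_⟩
    rw [Function.update_of_ne (a := 0) (by omega)]
    rcases hm.eq_or_lt with rfl | hm
    · rw [Function.update_self]
      refine ⟨hb', hbδ', hLK, hgr, fun i => ?_⟩
      rw [hosc', hosc, hcongr 0 (Nat.zero_le _), add_assoc]
    · have hm : m ≤ n := by omega
      rw [Function.update_of_ne (by omega)]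
      obtain ⟨h1, h2, h3, h4, h5⟩ := hb m hm
      refine ⟨h1, h2, h3.trans hKK', fun i ξ hξ => ?_, fun i => ?_⟩
      · rw [hae i ξ (h3 hξ.1)]
        exact h4 i ξ hξ
      · rw [hcongr m hm, hcongr 0 (Nat.zero_le _), h5]

/-- The combinatorial core: any number of consecutive oscillation numbers is realized,
simultaneously in all coordinates of a tuple from an unbounded family and up to a shift in each
coordinate, by ordinals from an uncountable set. -/
theorem exists_osc_eq_add [Finite ι] (hC : IsCSequence C) (he : IsCoherentFiniteToOne e)
    (hA : IsUnboundedFamily A) (hB : ¬ B.Countable) (n : ℕ) :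
    ∃ a ∈ A, ∃ b : ℕ → Omega1, ∀ m ≤ n, b m ∈ B ∧ (∀ i, a i < b m) ∧
      ∀ i, osc C e (a i) (b m) = osc C e (a i) (b 0) + m := by
  obtain ⟨δ, hδ⟩ := exists_isReflecting (C := C) (A := A) (B := B) he
  have hbot := bot_lt_of_isSuccLimit hδ.isSuccLimit
  obtain ⟨K, hK, a, ha, haδ, b, hb⟩ := hδ.exists_card_oscSet_eq_add hC he hA hB n
  have hunb := hδ.unbounded K hK (fun i x => e (a i) x) a ⟨ha, fun _ _ => rfl⟩ haδ
  obtain ⟨γ, hγδ, hγ⟩ : ∃ γ < δ, ∀ x ∈ (K : Set Omega1) ∪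
      ⋃ m ∈ Iic n, {x | x < δ ∧ e (b m) x ≠ e δ x}, x ≤ γ := by
    refine exists_lt_forall_le_of_finite hbot (K.finite_toSet.union
      ((finite_Iic n).biUnion fun m hm => he.coherent _ _ (hb m hm).2.1)) ?_
    rintro x (hx | hx)
    · exact hK x hx
    · simp only [mem_iUnion] at hx
      obtain ⟨_, _, hx, _⟩ := hx
      exact hx
  obtain ⟨θ, hθδ, hθ⟩ := hC.exists_forall_lt_lowerTrace hδ.isSuccLimit hγδ
  -- Reflect the tuple `a` to one between `θ` and `δ`.
  obtain ⟨a', ha', haθ⟩ := hδ.exists_below K hK _ hunb θ hθδ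
  have hosc : ∀ m ≤ n, ∀ i, osc C e (a' i) (b m) =
      (oscSet (e (a i)) (e (b m)) (lowerTrace C δ (b m))).card +
        (oscSet (e (a' i)) (e δ) (lowerTrace C (a' i) δ)).card := by
    intro m hm i
    obtain ⟨-, hbδ, hbK, hgr, -⟩ := hb m hm
    have hlow := hθ (a' i) (haθ i).1 (haθ i).2
    have hlt : ∀ x ∈ lowerTrace C δ (b m), ∀ y ∈ lowerTrace C (a' i) δ, x < y := fun x hx y hy =>
      (hγ x (.inl (hbK hx))).trans_lt (hlow y hy)
    have hae : ∀ x ∈ lowerTrace C δ (b m), e (a' i) x = e (a i) x := fun x hx =>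
      ha'.2 i ⟨x, hbK hx⟩
    rw [osc, hC.lowerTrace_eq_union (haθ i).2 hbδ.le hlt, card_oscSet_union hlt]
    · congr 2
      · exact oscSet_congr hae fun _ _ => rfl
      · refine oscSet_congr (fun _ _ => rfl) fun x hx => ?_
        have hxδ := (le_of_mem_lowerTrace hx).trans_lt (haθ i).2
        by_contra hne
        exact (hγ x (.inr (mem_biUnion hm ⟨hxδ, hne⟩))).not_gt (hlow x hx)
    · intro ξ η hξ _ hle
      rw [hae ξ hξ.1] at hle
      exact (hle.not_gt (hgr i ξ hξ)).elim
  refine ⟨a', ha'.1, b, fun m hm => ⟨(hb m hm).1, fun i => (haθ i).2.trans (hb m hm).2.1,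
    fun i => ?_⟩⟩
  rw [hosc m hm, hosc 0 (Nat.zero_le _), (hb m hm).2.2.2.2]
  omega

end EndExtension

/-! ### Kronecker's theorem -/

section Kronecker

open Filter Topology MeasureTheory UnitAddTorus

variable {ι : Type*} [Fintype ι]

theorem mFourier_add_apply (n : ι → ℤ) (x y : UnitAddTorus ι) :
    mFourier n (x + y) = mFourier n x * mFourier n y := by
  simp [mFourier, Finset.prod_mul_distrib, AddCircle.toCircle_add]

theorem mFourier_nsmul_apply (n : ι → ℤ) (m : ℕ) (x : UnitAddTorus ι) :
    mFourier n (m • x) = mFourier n x ^ m := by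
  induction m with
  | zero => simp [mFourier]
  | succ m ih => rw [succ_nsmul, mFourier_add_apply, ih, pow_succ]

theorem mFourier_apply_eq_one_iff (n : ι → ℤ) (x : UnitAddTorus ι) :
    mFourier n x = 1 ↔ ∑ i, n i • x i = 0 := by
  have h : mFourier n x = ((∑ i, n i • x i).toCircle : ℂ) := by
    simp only [mFourier, ContinuousMap.coe_mk, fourier_apply]
    induction (Finset.univ : Finset ι) using Finset.cons_induction with
    | empty => simp
    | cons a s ha ih => simp [Finset.prod_cons, Finset.sum_cons, ih, AddCircle.toCircle_add]
  rw [h, ← Circle.coe_one, Circle.coe_inj, ← AddCircle.toCircle_zero (T := (1 : ℝ)),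
    (AddCircle.injective_toCircle one_ne_zero).eq_iff]

theorem volume_real_univ_unitAddTorus :
    (volume : Measure (UnitAddTorus ι)).real univ = 1 := by
  rw [measureReal_def, ← pi_univ (univ : Set ι), volume_pi_pi]
  simp

/-- Weyl equidistribution for trigonometric polynomials. -/
theorem tendsto_average_of_mem_span {θ : UnitAddTorus ι}
    (h : ∀ n : ι → ℤ, ∑ i, n i • θ i = 0 → n = 0) {f : C(UnitAddTorus ι, ℂ)}
    (hf : f ∈ Submodule.span ℂ (range (mFourier (d := ι)))) :
    Tendsto (fun N : ℕ => (N : ℂ)⁻¹ * ∑ m ∈ Finset.range N, f (m • θ)) atTop (𝓝 (∫ x, f x)) := by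
  have hint : ∀ g : C(UnitAddTorus ι, ℂ), Integrable g := fun g =>
    g.continuous.integrable_of_hasCompactSupport (HasCompactSupport.of_compactSpace g)
  induction hf using Submodule.span_induction with
  | zero => simp
  | add f g _ _ hf hg =>
    simp only [ContinuousMap.add_apply, Finset.sum_add_distrib, mul_add]
    rw [integral_add (hint f) (hint g)]
    exact hf.add hg
  | smul c f _ hf =>
    simp only [ContinuousMap.smul_apply, smul_eq_mul, ← Finset.mul_sum]
    rw [integral_const_mul]
    simpa only [mul_left_comm] using hf.const_mul c
  | mem f hf =>
    obtain ⟨n, rfl⟩ := hf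
    simp only [mFourier_nsmul_apply]
    rcases eq_or_ne n 0 with rfl | hn
    · refine tendsto_const_nhds.congr' ?_
      filter_upwards [eventually_ne_atTop 0] with N hN
      simp [mFourier_zero, hN, volume_real_univ_unitAddTorus]
    · have hne : mFourier n θ ≠ 1 := fun h' => hn (h n ((mFourier_apply_eq_one_iff n θ).1 h'))
      have hnorm : ‖mFourier n θ‖ = 1 := by
        simp [mFourier, norm_prod, Circle.norm_coe]
      -- Translation by `θ` multiplies the integral of the character by its value at `θ`.
      have hzero : ∫ x, mFourier n x = 0 := by
        have h1 : ∫ x, mFourier n (θ + x) = ∫ x, mFourier n x :=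
          integral_add_left_eq_self (fun x => mFourier n x) θ
        simp only [mFourier_add_apply] at h1
        rw [integral_const_mul] at h1
        have h2 : (mFourier n θ - 1) * ∫ x, mFourier n x = 0 := by rw [sub_mul, h1]; ring
        exact (mul_eq_zero.1 h2).resolve_left (sub_ne_zero.2 hne)
      rw [hzero]
      simp only [geom_sum_eq hne]
      refine (tendsto_inv_atTop_nhds_zero_nat (𝕜 := ℂ)).zero_mul_isBoundedUnder_le ?_
      refine isBoundedUnder_of ⟨2 / ‖mFourier n θ - 1‖, fun N => ?_⟩
      simp only [Function.comp, norm_div]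
      gcongr
      refine (norm_sub_le _ _).trans ?_
      simp [hnorm]
      norm_num

/-- **Kronecker's theorem** on the additive torus. -/
theorem dense_range_nsmul {θ : UnitAddTorus ι}
    (h : ∀ n : ι → ℤ, ∑ i, n i • θ i = 0 → n = 0) : DenseRange fun m : ℕ => m • θ := by
  by_contra hd
  obtain ⟨p, hp⟩ : ∃ p, p ∉ closure (range fun m : ℕ => m • θ) := by
    simpa [DenseRange, Dense] using hd
  obtain ⟨f, hf0, hf1, hf⟩ := exists_continuous_zero_one_of_isClosed
    (isClosed_closure (s := range fun m : ℕ => m • θ)) (isClosed_singleton (x := p))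
    (disjoint_singleton_right.2 hp)
  have hpos : 0 < ∫ x, f x := f.continuous.integral_pos_of_hasCompactSupport_nonneg_nonzero
    (HasCompactSupport.of_compactSpace f) (fun x => (hf x).1)
    (x := p) (by rw [hf1 (mem_singleton p)]; simp)
  set F : C(UnitAddTorus ι, ℂ) := ⟨fun x => (f x : ℂ), by fun_prop⟩ with hF
  have hFint : ∫ x, F x = ((∫ x, f x : ℝ) : ℂ) := integral_ofReal
  set ε := (∫ x, f x) / 3 with hε
  have hε0 : 0 < ε := by positivity
  have hmem : F ∈ closure (Submodule.span ℂ (range (mFourier (d := ι))) : Set _) := by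
    rw [← Submodule.topologicalClosure_coe, span_mFourier_closure_eq_top]
    trivial
  obtain ⟨g, hg, hFg⟩ := Metric.mem_closure_iff.1 hmem ε hε0
  have hdist : ∀ x, ‖F x - g x‖ ≤ ε := fun x => by
    rw [← dist_eq_norm]
    exact (ContinuousMap.dist_apply_le_dist x).trans hFg.le
  have hgint : ‖∫ x, g x‖ ≤ ε := by
    refine le_of_tendsto (tendsto_average_of_mem_span h hg).norm (.of_forall fun N => ?_)
    have hb : ∀ m ∈ Finset.range N, ‖g (m • θ)‖ ≤ ε := fun m _ => by
      have h0 : F (m • θ) = 0 := by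
        simp [hF, hf0 (subset_closure (mem_range_self m))]
      simpa [h0] using hdist (m • θ)
    have hs := norm_sum_le_of_le _ hb
    rw [Finset.sum_const, Finset.card_range, nsmul_eq_mul] at hs
    rw [norm_mul, norm_inv, Complex.norm_natCast]
    rcases N.eq_zero_or_pos with rfl | hN
    · simpa using hε0.le
    · rw [inv_mul_le_iff₀ (by positivity)]
      exact hs
  have hint : ∀ g : C(UnitAddTorus ι, ℂ), Integrable g := fun g =>
    g.continuous.integrable_of_hasCompactSupport (HasCompactSupport.of_compactSpace g)
  have hsub : ‖(∫ x, F x) - ∫ x, g x‖ ≤ ε := by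
    rw [← integral_sub (hint F) (hint g)]
    simpa [volume_real_univ_unitAddTorus] using
      norm_integral_le_of_norm_le_const (μ := volume) (.of_forall hdist)
  have htri : ‖∫ x, F x‖ ≤ ε + ε := by
    calc ‖∫ x, F x‖ = ‖((∫ x, F x) - ∫ x, g x) + ∫ x, g x‖ := by rw [sub_add_cancel]
      _ ≤ ε + ε := (norm_add_le _ _).trans (add_le_add hsub hgint)
  rw [hFint, Complex.norm_real, Real.norm_of_nonneg hpos.le] at htri
  linarith

/-- **Kronecker's theorem**: the powers of a rationally independent tuple are dense in the
torus. -/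
theorem dense_range_pow {z : ι → Circle} (h : ∀ n : ι → ℤ, ∏ i, z i ^ n i = 1 → n = 0) :
    DenseRange fun m : ℕ => z ^ m := by
  have hsurj : Function.Surjective fun (x : UnitAddTorus ι) (i : ι) => (x i).toCircle := by
    intro w
    choose x hx using fun i => (AddCircle.homeomorphCircle (one_ne_zero (α := ℝ))).surjective (w i)
    exact ⟨x, funext fun i => (AddCircle.homeomorphCircle_apply one_ne_zero (x i)).symm.trans (hx i)⟩
  have hcont : Continuous fun (x : UnitAddTorus ι) (i : ι) => (x i).toCircle := by
    have := AddCircle.continuous_toCircle (T := (1 : ℝ))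
    fun_prop
  obtain ⟨θ, hθ⟩ := hsurj z
  have hθ' : ∀ i, (θ i).toCircle = z i := fun i => congrFun hθ i
  have hz : (fun m : ℕ => z ^ m) =
      (fun (x : UnitAddTorus ι) (i : ι) => (x i).toCircle) ∘ fun m : ℕ => m • θ := by
    ext m i
    simp [← hθ', AddCircle.toCircle_nsmul]
  rw [hz]
  refine hsurj.denseRange.comp (dense_range_nsmul fun n hn => h n ?_) hcont
  have := congrArg AddCircle.toCircle hn
  rw [AddCircle.toCircle_zero] at this
  rw [← this]
  simp only [← hθ', ← AddCircle.toCircle_zsmul]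
  induction (Finset.univ : Finset ι) using Finset.cons_induction with
  | empty => simp
  | cons a s ha ih => rw [Finset.prod_cons, Finset.sum_cons, ih, AddCircle.toCircle_add]

/-- By compactness, the number of powers needed to hit a translate of an open set is bounded. -/
theorem exists_forall_exists_mul_pow_mem {z : ι → Circle}
    (h : ∀ n : ι → ℤ, ∏ i, z i ^ n i = 1 → n = 0) {U : Set (ι → Circle)} (hU : IsOpen U)
    (hne : U.Nonempty) : ∃ n : ℕ, ∀ y, ∃ m ≤ n, y * z ^ m ∈ U := by
  have hcover : ∀ y, ∃ m : ℕ, y * z ^ m ∈ U := by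
    intro y
    obtain ⟨u, hu⟩ := hne
    obtain ⟨m, hm⟩ := (dense_range_pow h).exists_mem_open
      (hU.preimage (continuous_const_mul y)) ⟨y⁻¹ * u, by simpa using hu⟩
    exact ⟨m, hm⟩
  obtain ⟨t, ht⟩ := isCompact_univ.elim_finite_subcover (fun m : ℕ => {y | y * z ^ m ∈ U})
    (fun m => hU.preimage (continuous_mul_const _)) (fun y _ => mem_iUnion.2 (hcover y))
  refine ⟨t.sup id, fun y => ?_⟩
  obtain ⟨m, hm, hy⟩ : ∃ m ∈ t, y * z ^ m ∈ U := by simpa using ht (mem_univ y)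
  exact ⟨m, Finset.le_sup (f := id) hm, hy⟩

end Kronecker

/-! ### The hereditary Lindelöf property -/

section Lindelof

variable {C : Omega1 → Set Omega1} {e : Omega1 → Omega1 → ℕ} {z : Omega1 → Circle}
  {ι : Type*} {A : Set (ι → Omega1)} {B : Set Omega1}

theorem RationallyIndependent.eq_zero_of_prod_zpow_eq_one [Fintype ι]
    (hz : RationallyIndependent z) {a : ι → Omega1} (ha : Function.Injective a) {n : ι → ℤ}
    (h : ∏ i, z (a i) ^ n i = 1) : n = 0 := by
  have hli : LinearIndependent ℤ fun i => Additive.ofMul (z (a i)) := LinearIndependent.comp hz a ha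
  exact funext (Fintype.linearIndependent_iff.1 hli n (congrArg Additive.ofMul h))

theorem RationallyIndependent.pow_succ_ne_one (hz : RationallyIndependent z) (α : Omega1) (n : ℕ) :
    z α ^ (n + 1) ≠ 1 := by
  intro h
  have h' := hz.eq_zero_of_prod_zpow_eq_one (ι := Unit) (a := fun _ => α)
    (n := fun _ => (n : ℤ) + 1) (Function.injective_of_subsingleton _)
    (by rw [Fintype.prod_unique]; exact_mod_cast h)
  have : (n : ℤ) + 1 = 0 := congrFun h' ()
  omega

/-- Kronecker's theorem turns the consecutive oscillation numbers into a dense set of values of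
`o`. The number of powers it needs depends on the tuple, but is constant on an unbounded family. -/
theorem exists_o_mem [Fintype ι] (hC : IsCSequence C) (he : IsCoherentFiniteToOne e)
    (hz : RationallyIndependent z) (hA : IsUnboundedFamily A)
    (hinj : ∀ a ∈ A, Function.Injective a) (hB : ¬ B.Countable) {U : Set (ι → Circle)}
    (hU : IsOpen U) (hne : U.Nonempty) :
    ∃ a ∈ A, ∃ β ∈ B, (∀ i, a i < β) ∧ (fun i => o C e z (a i) β) ∈ U := by
  obtain ⟨n, hn⟩ := hA.exists_of_iUnion
    (D := fun n : ℕ => {a | ∀ y, ∃ m ≤ n, y * (fun i => z (a i)) ^ m ∈ U}) fun a ha =>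
      exists_forall_exists_mul_pow_mem
        (fun n h => hz.eq_zero_of_prod_zpow_eq_one (hinj a ha) h) hU hne
  obtain ⟨a, ⟨ha, haU⟩, b, hb⟩ := exists_osc_eq_add hC he hn hB n
  obtain ⟨m, hm, hmU⟩ := haU fun i => z (a i) ^ (osc C e (a i) (b 0) + 1)
  obtain ⟨hbB, hab, hosc⟩ := hb m hm
  refine ⟨a, ha, b m, hbB, hab, ?_⟩
  convert hmU using 1
  ext i
  simp only [o, hosc i, Pi.mul_apply, Pi.pow_apply, ← pow_add]
  congr 2
  omega

theorem exists_not_countable_inter {T : Set Omega1} (hT : ¬ T.Countable) {κ : Type*} [Countable κ]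
    {D : κ → Set Omega1} (h : ∀ γ ∈ T, ∃ k, γ ∈ D k) : ∃ k, ¬ (T ∩ D k).Countable := by
  by_contra! hc
  refine hT ((countable_iUnion hc).mono fun γ hγ => ?_)
  obtain ⟨k, hk⟩ := h γ hγ
  exact mem_iUnion.2 ⟨k, hγ, hk⟩

/-- A weak `Δ`-system lemma: a maximal finite set contained in uncountably many members of a family
of sets of bounded size is a root outside of which the family is point-countable. -/
theorem exists_root {T : Set Omega1} (hT : ¬ T.Countable) {F : Omega1 → Finset Omega1} {k : ℕ}
    (hF : ∀ γ ∈ T, (F γ).card ≤ k) :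
    ∃ r : Finset Omega1, ¬ {γ ∈ T | r ⊆ F γ}.Countable ∧
      ∀ x ∉ r, {γ ∈ T | r ⊆ F γ ∧ x ∈ F γ}.Countable := by
  classical
  let Q : ℕ → Prop := fun m => ∃ r : Finset Omega1, r.card = m ∧ ¬ {γ ∈ T | r ⊆ F γ}.Countable
  have hQ0 : Q 0 := ⟨∅, rfl, by simpa using hT⟩
  have hQk : ∀ m, Q m → m ≤ k := by
    rintro _ ⟨r, rfl, hr⟩
    obtain ⟨γ, hγ, -⟩ := not_countable_iff.1 hr ⊥
    exact (Finset.card_le_card hγ.2).trans (hF γ hγ.1)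
  obtain ⟨r, hr, hrT⟩ : Q (Nat.findGreatest Q k) := Nat.findGreatest_spec (hQk 0 hQ0) hQ0
  refine ⟨r, hrT, fun x hx => ?_⟩
  by_contra hc
  have hQ : Q (r.card + 1) := by
    refine ⟨insert x r, Finset.card_insert_of_notMem hx, fun h => hc (h.mono ?_)⟩
    rintro γ ⟨hγ, hrγ, hxγ⟩
    exact ⟨hγ, Finset.insert_subset hxγ hrγ⟩
  have := Nat.le_findGreatest (hQk _ hQ) hQ
  omega

/-- Uncountably many points `w_γ` do not admit basic neighbourhoods that exclude all later points.
That `γ` belongs to the set `F γ` of relevant coordinates ensures that an ordinal `β` above the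
part of `F γ` outside the root is also above `γ`. -/
theorem exists_lt_forall_dist_lt (hC : IsCSequence C) (he : IsCoherentFiniteToOne e)
    (hz : RationallyIndependent z) {T : Set Omega1} (hT : ¬ T.Countable)
    (F : Omega1 → Finset Omega1) (hF : ∀ γ ∈ T, γ ∈ F γ) (N : Omega1 → ℕ) :
    ∃ γ ∈ T, ∃ β ∈ T, γ < β ∧
      ∀ x ∈ F γ, dist (w C e z β x) (w C e z γ x) < 1 / ((N γ : ℝ) + 1) := by
  classical
  obtain ⟨⟨n, k⟩, hT₁⟩ := exists_not_countable_inter hT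
    (D := fun p : ℕ × ℕ => {γ | N γ = p.1 ∧ (F γ).card = p.2})
    fun γ _ => ⟨(N γ, (F γ).card), rfl, rfl⟩
  obtain ⟨r, hT₂, hr⟩ := exists_root hT₁ (F := F) (k := k) fun γ hγ => hγ.2.2.le
  set T₁ := T ∩ {γ | N γ = n ∧ (F γ).card = k} with hT₁def
  set T₂ := {γ ∈ T₁ | r ⊆ F γ} with hT₂def
  set ε : ℝ := 1 / ((n : ℝ) + 1) with hε
  have hε0 : 0 < ε := by positivity
  have henum : ∀ γ, ∃ f : Fin (k - r.card) → Omega1, γ ∈ T₂ → Function.Injective f ∧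
      ∀ x, x ∈ F γ \ r ↔ ∃ i, f i = x := by
    intro γ
    by_cases hγ : γ ∈ T₂
    · have hcard : (F γ \ r).card = k - r.card := by
        rw [Finset.card_sdiff_of_subset hγ.2, hγ.1.2.2]
      refine ⟨(F γ \ r).orderEmbOfFin hcard, fun _ => ⟨RelEmbedding.injective _, fun x => ?_⟩⟩
      have := Finset.range_orderEmbOfFin (F γ \ r) hcard
      rw [← Finset.mem_coe, ← this, mem_range]
    · exact ⟨fun _ => ⊥, fun h => (hγ h).elim⟩
  choose a ha using henum
  -- Thin out so that all restrictions of the `w_γ` to `F γ` are within `ε / 2` of a fixed tuple.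
  obtain ⟨D, hDc, hD⟩ := TopologicalSpace.exists_countable_dense
    ((r → Circle) × (Fin (k - r.card) → Circle))
  have := hDc.to_subtype
  obtain ⟨⟨d, _⟩, hT₃⟩ := exists_not_countable_inter hT₂ (D := fun d : D =>
      {γ | dist ((fun x : r => w C e z γ x), fun i => w C e z γ (a γ i)) d.1 < ε / 2}) fun γ _ => by
    obtain ⟨d, hd, h⟩ := Metric.mem_closure_iff.1
      (hD ((fun x : r => w C e z γ x), fun i => w C e z γ (a γ i))) (ε / 2) (by positivity)
    exact ⟨⟨d, hd⟩, h⟩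
  set T₃ := T₂ ∩
    {γ | dist ((fun x : r => w C e z γ x), fun i => w C e z γ (a γ i)) d < ε / 2} with hT₃def
  have hA : IsUnboundedFamily (a '' (T₃ \ r)) := by
    intro δ
    have hcount : ((⋃ x ∈ Iic δ \ r, {γ ∈ T₁ | r ⊆ F γ ∧ x ∈ F γ}) ∪ r).Countable :=
      (((countable_Iic δ).mono sdiff_subset).biUnion fun x hx => hr x hx.2).union
        r.countable_toSet
    obtain ⟨γ, hγ, hγ'⟩ := not_subset.1 fun h => hT₃ (hcount.mono h)
    rw [mem_union, not_or] at hγ'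
    refine ⟨_, ⟨γ, ⟨hγ, hγ'.2⟩, rfl⟩, fun i => ?_⟩
    by_contra hle
    have hmem := ((ha γ hγ.1).2 (a γ i)).2 ⟨i, rfl⟩
    rw [Finset.mem_sdiff] at hmem
    exact hγ'.1 (mem_biUnion (x := a γ i) ⟨not_lt.1 hle, hmem.2⟩ ⟨hγ.1.1, hγ.1.2, hmem.1⟩)
  obtain ⟨_, ⟨γ, ⟨hγ, hγr⟩, rfl⟩, β, hβ, hlt, hU⟩ := exists_o_mem hC he hz hA
    (by rintro _ ⟨γ, hγ, rfl⟩; exact (ha γ hγ.1.1).1) hT₃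
    (Metric.isOpen_ball (x := d.2) (ε := ε / 2)) ⟨d.2, Metric.mem_ball_self (by positivity)⟩
  have hNγ : N γ = n := hγ.1.1.2.1
  have hγd := hγ.2
  have hβd := hβ.2
  rw [mem_ofPred_eq, Prod.dist_eq, max_lt_iff] at hγd hβd
  refine ⟨γ, hγ.1.1.1, β, hβ.1.1.1, ?_, fun x hx => ?_⟩
  · obtain ⟨i, hi⟩ := ((ha γ hγ.1).2 γ).1 (Finset.mem_sdiff.2 ⟨hF γ hγ.1.1.1, hγr⟩)
    exact hi ▸ hlt i
  · rw [hNγ, ← hε]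
    by_cases hxr : x ∈ r
    · have h1 := (dist_pi_lt_iff (by positivity)).1 hγd.1 ⟨x, hxr⟩
      have h2 := (dist_pi_lt_iff (by positivity)).1 hβd.1 ⟨x, hxr⟩
      have := dist_triangle_right (w C e z β x) (w C e z γ x) (d.1 ⟨x, hxr⟩)
      dsimp only at h1 h2
      linarith
    · obtain ⟨i, rfl⟩ := ((ha γ hγ.1).2 x).1 (Finset.mem_sdiff.2 ⟨hx, hxr⟩)
      have h1 := (dist_pi_lt_iff (by positivity)).1 hγd.2 i
      have h2 := (dist_pi_lt_iff (by positivity)).1 (Metric.mem_ball.1 hU) i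
      have hw : w C e z β (a γ i) = o C e z (a γ i) β := if_pos (hlt i)
      have := dist_triangle_right (w C e z β (a γ i)) (w C e z γ (a γ i)) (d.2 i)
      dsimp only at h1 h2
      rw [hw] at this ⊢
      linarith

/-- Greedy choice along `ω₁`: keep `β` when no previously kept `γ` is related to it. -/
theorem exists_rightSeparated (S : Set Omega1) (R : Omega1 → Omega1 → Prop) :
    ∃ T ⊆ S, (∀ γ ∈ T, ∀ β ∈ T, γ < β → ¬ R γ β) ∧
      ∀ β ∈ S, β ∈ T ∨ ∃ γ ∈ T, R γ β := by
  let T : Omega1 → Prop := (wellFounded_lt (α := Omega1)).fix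
    fun β ih => β ∈ S ∧ ∀ γ (h : γ < β), ih γ h → ¬ R γ β
  have hT : ∀ β, T β ↔ β ∈ S ∧ ∀ γ < β, T γ → ¬ R γ β := fun β => by
    rw [show T β = _ from WellFounded.fix_eq _ _ _]
  refine ⟨{β | T β}, fun β hβ => ((hT β).1 hβ).1,
    fun γ hγ β hβ hlt => ((hT β).1 hβ).2 γ hlt hγ, fun β hβ => ?_⟩
  by_contra! h
  exact h.1 ((hT β).2 ⟨hβ, fun γ _ hγ => h.2 γ hγ⟩)

theorem exists_finset_dist_lt_subset {X : Set Omega1} {V : Set (X → Circle)} (hV : IsOpen V)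
    {f : Omega1 → Circle} (hf : X.domRestrict f ∈ V) (γ : Omega1) :
    ∃ F : Finset Omega1, γ ∈ F ∧ ∃ n : ℕ, ∀ g : Omega1 → Circle,
      (∀ x ∈ F, dist (g x) (f x) < 1 / ((n : ℝ) + 1)) → X.domRestrict g ∈ V := by
  classical
  obtain ⟨I, u, hu, hsub⟩ := isOpen_pi_iff.1 hV _ hf
  have hball : ∀ x : I, ∃ n : ℕ, Metric.ball (f x) (1 / ((n : ℝ) + 1)) ⊆ u x := by
    intro x
    obtain ⟨ε, hε, h⟩ := Metric.isOpen_iff.1 (hu x x.2).1 _ (hu x x.2).2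
    obtain ⟨n, hn⟩ := exists_nat_one_div_lt hε
    exact ⟨n, (Metric.ball_subset_ball hn.le).trans h⟩
  choose n hn using hball
  refine ⟨insert γ (I.image Subtype.val), Finset.mem_insert_self _ _, Finset.univ.sup n,
    fun g hg => hsub fun x hx => hn ⟨x, hx⟩ ?_⟩
  refine (hg x (Finset.mem_insert_of_mem (Finset.mem_image_of_mem _ hx))).trans_le ?_
  have : n ⟨x, hx⟩ ≤ Finset.univ.sup n := Finset.le_sup (Finset.mem_univ _)
  gcongr

theorem isLindelof_image_w (hC : IsCSequence C) (he : IsCoherentFiniteToOne e)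
    (hz : RationallyIndependent z) (X S : Set Omega1) :
    IsLindelof ((fun β => X.domRestrict (w C e z β)) '' S) := by
  refine isLindelof_of_countable_subcover fun {κ} V hV hcov => ?_
  by_contra! hno
  have hex : ∀ β ∈ S, ∃ k, X.domRestrict (w C e z β) ∈ V k := fun β hβ =>
    mem_iUnion.1 (hcov (mem_image_of_mem _ hβ))
  choose k hk using hex
  obtain ⟨T, hTS, hsep, hTcov⟩ := exists_rightSeparated S
    fun γ β => ∃ h : γ ∈ S, X.domRestrict (w C e z β) ∈ V (k γ h)
  have hT : ¬ T.Countable := by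
    intro hT
    have := hT.to_subtype
    refine hno (range fun γ : T => k γ (hTS γ.2)) (countable_range _) ?_
    rintro _ ⟨β, hβ, rfl⟩
    rcases hTcov β hβ with h | ⟨γ, hγ, h, hmem⟩
    · exact mem_biUnion ⟨⟨β, h⟩, rfl⟩ (hk β hβ)
    · exact mem_biUnion ⟨⟨γ, hγ⟩, rfl⟩ hmem
  have hnbhd : ∀ γ, ∃ F : Finset Omega1, γ ∈ F ∧ ∃ n : ℕ, ∀ h : γ ∈ S, ∀ g : Omega1 → Circle,
      (∀ x ∈ F, dist (g x) (w C e z γ x) < 1 / ((n : ℝ) + 1)) →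
        X.domRestrict g ∈ V (k γ h) := by
    intro γ
    by_cases h : γ ∈ S
    · obtain ⟨F, hF, n, hn⟩ := exists_finset_dist_lt_subset (hV (k γ h)) (hk γ h) γ
      exact ⟨F, hF, n, fun _ => hn⟩
    · exact ⟨{γ}, Finset.mem_singleton_self γ, 0, fun h' => (h h').elim⟩
  choose F hF n hn using hnbhd
  obtain ⟨γ, hγ, β, hβ, hlt, hdist⟩ :=
    exists_lt_forall_dist_lt hC he hz hT F (fun γ _ => hF γ) n
  exact hsep γ hγ β hβ hlt ⟨hTS hγ, hn γ (hTS hγ) _ hdist⟩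

theorem hereditarilyLindelofSpace_spaceL (hC : IsCSequence C) (he : IsCoherentFiniteToOne e)
    (hz : RationallyIndependent z) (X : Set Omega1) :
    HereditarilyLindelofSpace (spaceL C e z X) where
  isHereditarilyLindelof_univ t _ := by
    rw [Subtype.isLindelof_iff]
    obtain ⟨S, -, hS⟩ := subset_image_iff.1 (show Subtype.val '' t ⊆ spaceL C e z X from
      Subtype.coe_image_subset _ _)
    rw [← hS]
    exact isLindelof_image_w hC he hz X S

/-! ### Non-separability -/

/-- Any countably many functions `w_β` take the value `1` at a common `ξ ∈ X`, while `w_γ(ξ) ≠ 1`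
for every `γ ∈ X` above `ξ`. -/
theorem not_separableSpace_spaceL (hz : RationallyIndependent z) {X : Set Omega1}
    (hX : ¬ X.Countable) : ¬ TopologicalSpace.SeparableSpace (spaceL C e z X) := by
  rintro ⟨D, hDc, hD⟩
  have hβ : ∀ f : spaceL C e z X, ∃ β ∈ X, X.domRestrict (w C e z β) = f := fun f => f.2
  choose b hbX hb using hβ
  obtain ⟨δ, hδ⟩ := exists_forall_lt_of_countable (hDc.image b)
  obtain ⟨ξ, hξ, hδξ⟩ := not_countable_iff.1 hX δ
  obtain ⟨γ, hγ, hξγ⟩ := not_countable_iff.1 hX ξ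
  have hopen : IsOpen {f : spaceL C e z X | f.1 ⟨ξ, hξ⟩ ≠ 1} :=
    isOpen_ne.preimage ((continuous_apply _).comp continuous_subtype_val)
  obtain ⟨f, hf, hfD⟩ := hD.inter_open_nonempty _ hopen
    ⟨⟨X.domRestrict (w C e z γ), γ, hγ, rfl⟩, by
      simpa [w, hξγ, o] using hz.pow_succ_ne_one ξ _⟩
  refine hf ?_
  rw [← hb f]
  exact if_neg ((hδ _ (mem_image_of_mem b hfD)).trans hδξ).not_gt

theorem isLSpace_spaceL (hC : IsCSequence C) (he : IsCoherentFiniteToOne e)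
    (hz : RationallyIndependent z) {X : Set Omega1} (hX : ¬ X.Countable) :
    IsLSpace (spaceL C e z X) where
  t3 := inferInstance
  hereditarilyLindelof := hereditarilyLindelofSpace_spaceL hC he hz X
  not_separable := not_separableSpace_spaceL hz hX

end Lindelof

/-! ### Existence of the data -/

section Existence

variable {C : Omega1 → Set Omega1} {α β ξ : Omega1}

theorem exists_isCSequence : ∃ C, IsCSequence C := by
  have h : ∀ α : Omega1, ∃ c : Set Omega1, (∀ ξ, ξ ⋖ α → c = {ξ}) ∧
      (Order.IsSuccLimit α →
        c ⊆ Iio α ∧ (∀ ξ < α, ∃ η ∈ c, ξ ≤ η) ∧ Nonempty (ℕ ≃o c)) := by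
    intro α
    by_cases hα : Order.IsSuccLimit α
    · have := (countable_Iio α).to_subtype
      have : Nonempty (Iio α) := ⟨⟨⊥, bot_lt_of_isSuccLimit hα⟩⟩
      have : NoMaxOrder (Iio α) := ⟨fun x => by
        obtain ⟨y, hxy, hy⟩ := exists_lt_lt_of_isSuccLimit hα x.2
        exact ⟨⟨y, hy⟩, hxy⟩⟩
      obtain ⟨u, hu⟩ := Filter.exists_seq_tendsto (Filter.atTop : Filter (Iio α))
      obtain ⟨φ, hφ, huφ⟩ := Filter.strictMono_subseq_of_tendsto_atTop hu
      have hmono : StrictMono fun n => (u (φ n) : Omega1) := fun m n h => huφ h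
      refine ⟨range fun n => (u (φ n) : Omega1), fun ξ hξ => (hα.2 ξ hξ).elim, fun _ => ⟨?_, ?_,
        ⟨hmono.orderIso _⟩⟩⟩
      · rintro _ ⟨n, rfl⟩
        exact (u (φ n)).2
      · intro ξ hξ
        obtain ⟨n, hn⟩ := ((hu.comp hφ.tendsto_atTop).eventually_ge_atTop ⟨ξ, hξ⟩).exists
        exact ⟨_, mem_range_self n, hn⟩
    · by_cases h : ∃ ξ, ξ ⋖ α
      · obtain ⟨ξ, hξ⟩ := h
        exact ⟨{ξ}, fun ξ' hξ' => by rw [hξ.unique_left hξ'], fun h => (hα h).elim⟩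
      · exact ⟨∅, fun ξ hξ => (h ⟨ξ, hξ⟩).elim, fun h => (hα h).elim⟩
  choose C hC using h
  exact ⟨C, fun ξ α h => (hC α).1 ξ h, fun α h => ((hC α).2 h).1, fun α h => ((hC α).2 h).2.1,
    fun α h => ((hC α).2 h).2.2⟩

open Classical in
/-- Todorcevic's maximal weight function `ρ₁`: the largest size of a set `C_{β_i} ∩ ξ` along the
walk from `α` to `ξ`. -/
noncomputable def maxWeight (C : Omega1 → Set Omega1) (α ξ : Omega1) : ℕ :=
  if _h : ξ < α ∧ walkStep C ξ α < α then
    max (C α ∩ Iio ξ).ncard (maxWeight C (walkStep C ξ α) ξ)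
  else 0
termination_by α
decreasing_by exact _h.2

theorem IsCSequence.inter_Iio_walkStep (hC : IsCSequence C) (h : ξ < α) :
    C α ∩ Iio (walkStep C ξ α) = C α ∩ Iio ξ := by
  ext x
  simp only [mem_inter_iff, mem_Iio]
  refine and_congr_right fun hx => ⟨fun hlt => ?_, fun hlt => hlt.trans_le (hC.le_walkStep h)⟩
  by_contra hle
  exact notMem_of_lt_csInf' hlt ⟨hx, hle⟩

theorem IsCSequence.maxWeight_of_lt (hC : IsCSequence C) (h : ξ < α) :
    maxWeight C α ξ = max (C α ∩ Iio (walkStep C ξ α)).ncard (maxWeight C (walkStep C ξ α) ξ) := by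
  rw [hC.inter_Iio_walkStep h, maxWeight, dif_pos ⟨h, hC.walkStep_lt h⟩]

theorem IsCSequence.finite_ncard_le (hC : IsCSequence C) (hα : ⊥ < α) (n : ℕ) :
    {c ∈ C α | (C α ∩ Iio c).ncard ≤ n}.Finite := by
  have hmono : ∀ c ∈ C α, ∀ c' ∈ C α, c < c' → (C α ∩ Iio c).ncard < (C α ∩ Iio c').ncard := by
    intro c hc c' hc' hlt
    refine ncard_lt_ncard ⟨inter_subset_inter_right _ (Iio_subset_Iio hlt.le), fun hsub => ?_⟩
      (hC.finite_inter_Iio (hC.lt_of_mem hα hc'))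
    exact lt_irrefl c (hsub ⟨hc, hlt⟩).2
  refine Finite.of_injOn (f := fun c => (C α ∩ Iio c).ncard) (t := Iic n) (fun c hc => hc.2) ?_
    (finite_Iic n)
  intro c hc c' hc' heq
  rcases lt_trichotomy c c' with h | h | h
  · exact ((hmono c hc.1 c' hc'.1 h).ne heq).elim
  · exact h
  · exact ((hmono c' hc'.1 c hc.1 h).ne' heq).elim

theorem IsCSequence.finite_maxWeight_le (hC : IsCSequence C) (α : Omega1) (n : ℕ) :
    {ξ | ξ < α ∧ maxWeight C α ξ ≤ n}.Finite := by
  induction α using WellFoundedLT.induction with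
  | ind α ih =>
    rcases eq_or_ne α ⊥ with rfl | hα
    · simp
    have hα := bot_lt_iff_ne_bot.2 hα
    refine ((hC.finite_ncard_le hα n).biUnion (t := fun c =>
      insert c {ξ | ξ < c ∧ maxWeight C c ξ ≤ n}) fun c hc =>
        (ih c (hC.lt_of_mem hα hc.1)).insert c).subset ?_
    rintro ξ ⟨hξ, hle⟩
    rw [hC.maxWeight_of_lt hξ, max_le_iff] at hle
    refine mem_biUnion ⟨(hC.walkStep_mem hξ).1, hle.1⟩ ?_
    rcases (hC.le_walkStep hξ).eq_or_lt with h | h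
    · exact .inl h
    · exact .inr ⟨h, hle.2⟩

theorem IsCSequence.finite_maxWeight_ne (hC : IsCSequence C) (h : β < α) :
    {ξ | ξ < β ∧ maxWeight C α ξ ≠ maxWeight C β ξ}.Finite := by
  induction α using WellFoundedLT.induction generalizing β with
  | ind α ih =>
    have hα : ⊥ < α := bot_le.trans_lt h
    have hcβ : ∀ c < α, {ξ | ξ < c ∧ ξ < β ∧ maxWeight C c ξ ≠ maxWeight C β ξ}.Finite := by
      intro c hc
      rcases lt_trichotomy c β with hlt | rfl | hlt
      · exact (ih β h hlt).subset fun ξ hξ => ⟨hξ.1, hξ.2.2.symm⟩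
      · simp
      · exact (ih c hc hlt).subset fun ξ hξ => hξ.2
    -- The first step of the walk from `α` to some `ξ < β` takes only finitely many values.
    have hfin : (insert (walkStep C β α) (C α ∩ Iio β)).Finite := (hC.finite_inter_Iio h).insert _
    refine (hfin.biUnion (t := fun c => insert c
      ({ξ | ξ < c ∧ ξ < β ∧ maxWeight C c ξ ≠ maxWeight C β ξ} ∪
        {ξ | ξ < c ∧ maxWeight C c ξ ≤ (C α ∩ Iio c).ncard})) fun c hc => ?_).subset ?_
    · have hcα : c < α := by
        rcases hc with rfl | hc
        · exact hC.walkStep_lt h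
        · exact hC.lt_of_mem hα hc.1
      exact ((hcβ c hcα).union (hC.finite_maxWeight_le c _)).insert c
    · rintro ξ ⟨hξ, hne⟩
      have hξα := hξ.trans h
      refine mem_biUnion (x := walkStep C ξ α) ?_ ?_
      · obtain ⟨hmem, -⟩ := hC.walkStep_mem hξα
        by_cases hlt : walkStep C ξ α < β
        · exact .inr ⟨hmem, hlt⟩
        · refine .inl (le_antisymm ?_ ?_)
          · exact csInf_le' ⟨(hC.walkStep_mem h).1, not_lt.2 (hξ.le.trans (hC.le_walkStep h))⟩
          · exact csInf_le' ⟨hmem, hlt⟩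
      · rcases (hC.le_walkStep hξα).eq_or_lt with heq | hlt
        · exact .inl heq
        · refine .inr ?_
          by_cases hle : maxWeight C (walkStep C ξ α) ξ ≤ (C α ∩ Iio (walkStep C ξ α)).ncard
          · exact .inr ⟨hlt, hle⟩
          · refine .inl ⟨hlt, hξ, ?_⟩
            rwa [hC.maxWeight_of_lt hξα, max_eq_right (not_le.1 hle).le] at hne

theorem IsCSequence.isCoherentFiniteToOne_maxWeight (hC : IsCSequence C) :
    IsCoherentFiniteToOne (maxWeight C) where
  finiteToOne α n := (hC.finite_maxWeight_le α n).subset fun _ hξ => ⟨hξ.1, hξ.2.le⟩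
  coherent _ _ h := hC.finite_maxWeight_ne h

theorem exists_rationallyIndependent : ∃ z, RationallyIndependent z := by
  obtain ⟨b, hb⟩ : ∃ b : Option Omega1 → ℝ, LinearIndependent ℚ b := by
    have hle : Cardinal.mk (Option Omega1) ≤ Cardinal.mk (Module.Free.ChooseBasisIndex ℚ ℝ) := by
      rw [← Module.Free.rank_eq_card_chooseBasisIndex, Real.rank_rat_real]
      simpa using Cardinal.aleph_one_le_continuum
    obtain ⟨f⟩ := hle
    exact ⟨_, (Module.Free.chooseBasis ℚ ℝ).linearIndependent.comp f f.injective⟩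
  have hb0 : b none ≠ 0 := hb.ne_zero none
  refine ⟨fun α => Circle.exp (2 * Real.pi * (b (some α) / b none)), ?_⟩
  refine linearIndependent_iff'.2 fun s g hg => ?_
  have hexp : ∀ s : Finset Omega1, ∑ i ∈ s, g i •
      Additive.ofMul (Circle.exp (2 * Real.pi * (b (some i) / b none))) =
      Additive.ofMul (Circle.exp (∑ i ∈ s, g i * (2 * Real.pi * (b (some i) / b none)))) := by
    intro s
    induction s using Finset.cons_induction with
    | empty => simp
    | cons a s ha ih =>
      rw [Finset.sum_cons, Finset.sum_cons, ih, Circle.exp_add, ofMul_mul, ← zsmul_eq_mul,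
        Circle.exp_zsmul, ofMul_zpow]
  rw [hexp] at hg
  obtain ⟨k, hk⟩ := Circle.exp_eq_one.1 (Additive.ofMul.injective hg)
  -- Clearing denominators gives a rational relation between the reals `b`.
  have hrel : ∑ i ∈ Finset.insertNone s, (i.elim (-(k : ℚ)) fun i => (g i : ℚ)) • b i = 0 := by
    rw [Finset.sum_insertNone]
    have hsum : ∑ i ∈ s, (g i : ℝ) * (2 * Real.pi * (b (some i) / b none)) =
        2 * Real.pi / b none * ∑ i ∈ s, (g i : ℝ) * b (some i) := by
      rw [Finset.mul_sum]
      exact Finset.sum_congr rfl fun i _ => by ring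
    rw [hsum] at hk
    have hpi := Real.pi_ne_zero
    have : ∑ i ∈ s, (g i : ℝ) * b (some i) = k * b none := by
      field_simp at hk
      linarith
    simp only [Option.elim, Rat.smul_def, Rat.cast_neg, Rat.cast_intCast]
    rw [this]
    ring
  intro i hi
  have := linearIndependent_iff'.1 hb _ _ hrel (some i) (by simpa using hi)
  simpa using this

end Existence

end MooreLSpace

theorem mainTheorem1 :
    (∀ (C : MooreLSpace.Omega1 → Set MooreLSpace.Omega1)
        (e : MooreLSpace.Omega1 → MooreLSpace.Omega1 → ℕ)
        (z : MooreLSpace.Omega1 → Circle),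
        MooreLSpace.IsCSequence C →
        MooreLSpace.IsCoherentFiniteToOne e →
        MooreLSpace.RationallyIndependent z →
          (∀ X : Set MooreLSpace.Omega1,
            HereditarilyLindelofSpace (MooreLSpace.spaceL C e z X)) ∧
          (∀ X : Set MooreLSpace.Omega1, ¬ X.Countable →
            MooreLSpace.IsLSpace (MooreLSpace.spaceL C e z X))) ∧
    (∃ (Y : Type) (_ : TopologicalSpace Y), MooreLSpace.IsLSpace Y) := by
  refine ⟨fun C e z hC he hz =>
    ⟨fun X => MooreLSpace.hereditarilyLindelofSpace_spaceL hC he hz X,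
      fun X hX => MooreLSpace.isLSpace_spaceL hC he hz hX⟩, ?_⟩
  obtain ⟨C, hC⟩ := MooreLSpace.exists_isCSequence
  obtain ⟨z, hz⟩ := MooreLSpace.exists_rationallyIndependent
  exact ⟨_, _, MooreLSpace.isLSpace_spaceL hC hC.isCoherentFiniteToOne_maxWeight hz
    Set.not_countable_univ⟩
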